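/- Let $\mathbb K$ be an algebraically closed field of characteristic zero. Let $f_0,\dots,f_3\in\mathbb K[s,u]$ be homogeneous of degree $m$ and $g_0,\dots,g_3\in\mathbb K[t,v]$ homogeneous of degree $n\ge 1$, with $\gcd(f_0,\dots,f_3)=\gcd(g_0,\dots,g_3)=1$, $f_0\ne0$ and $g_0\neq 0$. Let $X_{\mathbf h}\subseteq\mathbb P^3$ be the translational surface they generate, i.e. the (Zariski closed) image of $\mathbf h=(h_0,\dots,h_3):\mathbb P^1\times\mathbb P^1\dashrightarrow\mathbb P^3$, $h_i=f_0g_i+f_ig_0\in R=\mathbb K[s,u,t,v]$. A polynomial of $\mathbb K[t,v,w,x,y,z]$ that is homogeneous in $w,x,y,z$ is said to follow $\mathbf h$ if it becomes $0$ in $R$ on substituting $h_0,h_1,h_2,h_3$ for $w,x,y,z$. Let $\mathbf a,\mathbf b,\mathbf c\in\mathbb K[s,u]^4$ be a basis of the syzygy module $\{\mathbf p:\sum_i f_ip_i=0\}$ of $\mathbf f$, where all entries of $\mathbf a,\mathbf b,\mathbf c$ are homogeneous of degree $\mu_1\le\mu_2\le\mu_3$, respectively. Put $$N_{\mathbf g}=\begin{bmatrix}\frac{g_0}2&-\frac{g_1}2&-\frac{g_2}2&-\frac{g_3}2\\0&g_0&0&0\\0&0&g_0&0\\0&0&0&g_0\end{bmatrix},\qquad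 \mathbf A=\frac{N_{\mathbf g}\mathbf a}{\gcd(N_{\mathbf g}\mathbf a)},\quad \mathbf B=\frac{N_{\mathbf g}\mathbf b}{\gcd(N_{\mathbf g}\mathbf b)},\quad \mathbf C=\frac{N_{\mathbf g}\mathbf c}{\gcd(N_{\mathbf g}\mathbf c)},$$ where $\gcd$ of a vector is the greatest common divisor in $R$ of its entries, and let $\mathbf x=[w,x,y,z]$, so that $\mathbf{xA}=A_0w+A_1x+A_2y+A_3z$, and likewise $\mathbf{xB}$, $\mathbf{xC}$. Write $\mathrm{Res}_{su}$ and $\mathrm{Res}_{tv}$ for the homogeneous Sylvester resultants with respect to $s,u$ and to $t,v$, formed with the degrees in these variables. Theorem. Assume that $\dim_{\mathbb K}\operatorname{span}(f_0,f_1,f_2,f_3)=3$. Then $\mathbf{xA}\in\mathbb K[t,v,w,x,y,z]$, and $\mathbf{xA}$ does not divide $\mathrm{Res}_{su}(\mathbf{xB},\mathbf{xC})\in\mathbb K[t,v,w,x,y,z]$. The polynomial $\mathrm{Res}_{su}(\mathbf{xB},\mathbf{xC})$ has an irreducible factor that follows $\mathbf h$. There is an implicit equation $F$ of $X_{\mathbf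 h}$, i.e. an irreducible form $F\in\mathbb K[w,x,y,z]$ with zero locus $X_{\mathbf h}$, and for every irreducible factor $F_1\in\mathbb K[t,v,w,x,y,z]$ of $\mathrm{Res}_{su}(\mathbf{xB},\mathbf{xC})$ that follows $\mathbf h$, the resultant $\mathrm{Res}_{tv}(\mathbf{xA},F_1)$ is a nonzero polynomial in $\mathbb K[w,x,y,z]$ and factors as $\mathrm{Res}_{tv}(\mathbf{xA},F_1)=EF$ with $E\in\mathbb K[w,x,y,z]$. -/

import Mathlib

open MvPolynomial

namespace TransSurf

noncomputable section

/-- Binary forms, i.e. polynomials in two variables: `K[s,u]` or `K[t,v]`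
(the variable with index `0` is `s` resp. `t`, the one with index `1` is `u` resp. `v`). -/
abbrev Bin (K : Type*) [CommRing K] := MvPolynomial (Fin 2) K

/-- `R = K[s,u,t,v]`, written as `K[t,v][s,u]`. -/
abbrev BiRing (K : Type*) [CommRing K] := MvPolynomial (Fin 2) (Bin K)

/-- `K[w,x,y,z]`, the coordinate ring of projective three-space. -/
abbrev Coord (K : Type*) [CommRing K] := MvPolynomial (Fin 4) K

/-- `K[t,v,w,x,y,z]`, written as `K[w,x,y,z][t,v]`. -/
abbrev TVCoord (K : Type*) [CommRing K] := MvPolynomial (Fin 2) (Coord K)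

/-- `K[s,u,t,v,w,x,y,z]`, written as `K[t,v,w,x,y,z][s,u]`. -/
abbrev FullRing (K : Type*) [CommRing K] := MvPolynomial (Fin 2) (TVCoord K)

section Resultant

variable {D : Type*} [CommRing D]

/-- The polynomial `p(X, 1)` of a form `p(x, y)`; for a form of degree `d` its coefficient at `X ^ i`
is the coefficient of `p` at `x ^ i * y ^ (d - i)`. -/
def dehomogenize (p : MvPolynomial (Fin 2) D) : Polynomial D :=
  aeval ![Polynomial.X, 1] p

/-- The homogeneous Sylvester resultant of two nonzero binary forms over `D`: the determinant of the
Sylvester matrix of size `deg p + deg q`, formed with the degrees of the forms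
(not with the degrees of their dehomogenizations). -/
def homResultant (p q : MvPolynomial (Fin 2) D) : D :=
  Polynomial.resultant (dehomogenize p) (dehomogenize q) p.totalDegree q.totalDegree

end Resultant

/-- `d` is a greatest common divisor of the entries of `v`. -/
def IsGCDOf {ι D : Type*} [CommRing D] (d : D) (v : ι → D) : Prop :=
  (∀ i, d ∣ v i) ∧ ∀ e, (∀ i, e ∣ v i) → e ∣ d

/-- `V = v / gcd(v)`, for some choice of the greatest common divisor (which is unique up to a unit). -/
def IsPrimitivePart {ι D : Type*} [CommRing D] (v V : ι → D) : Prop :=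
  ∃ d, IsGCDOf d v ∧ v = d • V

section Curves

variable {K : Type*} [Field K]

/-- The syzygy module of `f₀, f₁, f₂, f₃`. -/
def syzygies (f : Fin 4 → Bin K) : Submodule (Bin K) (Fin 4 → Bin K) where
  carrier := {a | ∑ i, f i * a i = 0}
  add_mem' := by
    intro a b ha hb
    simp only [Set.mem_ofPred_eq, Pi.add_apply, mul_add, Finset.sum_add_distrib] at *
    rw [ha, hb, add_zero]
  zero_mem' := by simp
  smul_mem' := by
    intro c a ha
    simp only [Set.mem_ofPred_eq, Pi.smul_apply, smul_eq_mul] at *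
    rw [Finset.sum_congr rfl fun i _ => mul_left_comm (f i) c (a i), ← Finset.mul_sum, ha, mul_zero]

/-- `φ` is the syzygy matrix of `f` in a graded free resolution
`0 → ⨁ A(-m - μ i) → A(-m)⁴ → (f) → 0` over `A = K[s,u]`, with ordered degrees: its columns
are homogeneous of degrees `μ 0 ≤ μ 1 ≤ μ 2` and form a basis of the syzygy module. -/
structure IsSyzygyMatrix (f : Fin 4 → Bin K) (μ : Fin 3 → ℕ)
    (φ : Matrix (Fin 4) (Fin 3) (Bin K)) : Prop where
  isHomogeneous : ∀ i j, (φ i j).IsHomogeneous (μ j)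
  monotone : Monotone μ
  linearIndependent : LinearIndependent (Bin K) fun j i => φ i j
  span_eq : Submodule.span (Bin K) (Set.range fun j i => φ i j) = syzygies f

/-- A polynomial in `s, u` as an element of `K[s,u,t,v]`. -/
def inSU : Bin K →+* BiRing K := MvPolynomial.map C

/-- A polynomial in `t, v` as an element of `K[s,u,t,v]`. -/
def inTV : Bin K →+* BiRing K := C

/-- The parameterization `h = f₀ g + g₀ f` of the translational surface. -/
def translational (f g : Fin 4 → Bin K) (i : Fin 4) : BiRing K :=
  inSU (f 0) * inTV (g i) + inSU (f i) * inTV (g 0)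

/-- The matrix `N_g` (with entries in `K[t,v]`) carrying syzygies of `f` to syzygies of `h`. -/
def Nmat (g : Fin 4 → Bin K) : Matrix (Fin 4) (Fin 4) (Bin K) :=
  !![C (1 / 2) * g 0, -(C (1 / 2) * g 1), -(C (1 / 2) * g 2), -(C (1 / 2) * g 3);
     0, g 0, 0, 0;
     0, 0, g 0, 0;
     0, 0, 0, g 0]

/-- The syzygy `N_g a` of `h` induced by a syzygy `a` of `f`. -/
def inducedSyzygy (g : Fin 4 → Bin K) (a : Fin 4 → Bin K) : Fin 4 → BiRing K :=
  ((Nmat g).map inTV).mulVec fun i => inSU (a i)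

/-- The inclusion of `K[s,u,t,v]` in `K[s,u,t,v,w,x,y,z]`. -/
def toFull : BiRing K →+* FullRing K :=
  MvPolynomial.map (MvPolynomial.map C)

/-- The moving plane `A₀ w + A₁ x + A₂ y + A₃ z`. -/
def movingPlane (A : Fin 4 → BiRing K) : FullRing K :=
  ∑ i, toFull (A i) * C (C (X i))

/-- Substitution of `h₀, h₁, h₂, h₃` for `w, x, y, z`, keeping `t` and `v`. -/
def substParam (h : Fin 4 → BiRing K) : TVCoord K →+* BiRing K :=
  eval₂Hom (eval₂Hom (inTV.comp C) h) fun j => inTV (X j)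

/-- `L` (with coefficients in `K[t,v]`) is a moving surface, i.e. homogeneous in `w, x, y, z`, and it
follows the parameterization `h`. -/
def Follows (h : Fin 4 → BiRing K) (L : TVCoord K) : Prop :=
  (∃ d : ℕ, ∀ k, (coeff k L).IsHomogeneous d) ∧ substParam h L = 0

/-- The value of `h` at `(s,u) = p`, `(t,v) = q`. -/
def evalParam (h : Fin 4 → BiRing K) (p q : Fin 2 → K) : Fin 4 → K :=
  fun i => eval p (MvPolynomial.map (eval q) (h i))

/-- The image in `ℙ³` of the rational map `ℙ¹ × ℙ¹ ⇢ ℙ³` defined by `h` (points of `ℙ¹` are given by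
nonzero coordinate vectors; basepoints are left out). -/
def image (h : Fin 4 → BiRing K) : Set (Projectivization K (Fin 4 → K)) :=
  {P | ∃ p q : Fin 2 → K, p ≠ 0 ∧ q ≠ 0 ∧
    ∃ hne : evalParam h p q ≠ 0, P = Projectivization.mk K (evalParam h p q) hne}

/-- The Zariski closure of a set of points of `ℙ³`. -/
def zariskiClosure (S : Set (Projectivization K (Fin 4 → K))) :
    Set (Projectivization K (Fin 4 → K)) :=
  {P | ∀ (d : ℕ) (G : Coord K), G.IsHomogeneous d → (∀ Q ∈ S, eval Q.rep G = 0) → eval P.rep G = 0}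

/-- `F` is an implicit equation of the surface `X_h` parameterized by `h`: it is an irreducible form
whose zero locus in `ℙ³` is the (closed) image of `h`. It is unique up to a nonzero constant. -/
def IsImplicitEquation (h : Fin 4 → BiRing K) (F : Coord K) : Prop :=
  Irreducible F ∧ (∃ d : ℕ, F.IsHomogeneous d) ∧
    {P : Projectivization K (Fin 4 → K) | eval P.rep F = 0} = zariskiClosure (image h)

end Curves

end

end TransSurf

/-! The matrix `N_g` satisfies `N_gᵀ h = g₀² f`, so it carries syzygies of `f` to syzygies of `h`,
and over a point `q` with `g₀(q) ≠ 0` it identifies the moving planes of `h` with those of `f`. As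
`f` spans a space of dimension 3, it has one constant syzygy up to scalars: `μ 0 = 0` and `μ 1 > 0`.
Hence `xA` is free of `s, u`; being linear in `w, x, y, z` and primitive, it is prime
(`prime_tvPlane`).

Non-divisibility (`not_tvPlane_dvd_resultant`): over such a `q`, the plane `xA = 0` corresponds to
the plane containing the curve `f`. A point of it at which `xB` and `xC` have a common root `p`
corresponds to a multiple of `f(p)`, and the cone over a curve does not fill a plane. So `Res_su(xB,
xC)` is nonzero and not a multiple of `xA`. It vanishes on substituting `h`, because `(s, u)` is
then a common root; hence some irreducible factor follows `h`.

Such a factor `F₁` is prime to `xA`, so `Res_tv(xA, F₁) ≠ 0`. This resultant vanishes on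
substituting `h`, now with common root `(t, v)`. Three of the `hᵢ` are algebraically independent (a
Jacobian argument with Wronskians), so the kernel of `K[w,x,y,z] → R` is generated by one
irreducible form `F` (`dvd_of_paramHom_eq_zero`), the implicit equation; therefore `F` divides the
resultant. When `xA` and `F₁` are both free of `t, v`, their resultant is the empty determinant `1`.
This case cannot occur: `F` would divide both, forcing `xA ∣ F₁`. -/

namespace TransSurf

noncomputable section

/-! ### Gradings as scaling homomorphisms, and factors of forms -/

section Grading

variable {S : Type*} [CommRing S]

/-- `x` has degree `d` for the grading described by the homomorphism `σ : S → S[T]`. -/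
def ScalesBy (σ : S →+* Polynomial S) (d : ℕ) (x : S) : Prop :=
  σ x = Polynomial.X ^ d * Polynomial.C x

theorem eq_monomial_of_natDegree_eq_natTrailingDegree {p : Polynomial S}
    (h : p.natDegree = p.natTrailingDegree) :
    p = Polynomial.X ^ p.natDegree * Polynomial.C (p.eval 1) := by
  have key : p = Polynomial.X ^ p.natDegree * Polynomial.C (p.coeff p.natDegree) := by
    ext k
    rw [Polynomial.X_pow_mul_C, Polynomial.coeff_C_mul_X_pow]
    split_ifs with hk
    · rw [hk]
    · rcases lt_or_gt_of_ne hk with hlt | hgt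
      · exact Polynomial.coeff_eq_zero_of_lt_natTrailingDegree (h ▸ hlt)
      · exact Polynomial.coeff_eq_zero_of_natDegree_lt hgt
  have h1 : p.eval 1 = p.coeff p.natDegree := by
    conv_lhs => rw [key]
    simp
  rw [h1]
  exact key

/-- Over a domain, degree and trailing degree in `T` are both additive. They agree for the product,
a monomial in `T`, hence for each factor; setting `T = 1` recovers the coefficient. -/
theorem ScalesBy.of_mul [IsDomain S] {σ : S →+* Polynomial S} (hσ : ∀ x, (σ x).eval 1 = x)
    {d : ℕ} {x y : S} (hxy : ScalesBy σ d (x * y)) (h0 : x * y ≠ 0) :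
    ∃ e e', ScalesBy σ e x ∧ ScalesBy σ e' y ∧ e + e' = d := by
  have hinj : ∀ z, z ≠ 0 → σ z ≠ 0 := by
    intro z hz h
    apply hz
    rw [← hσ z, h, Polynomial.eval_zero]
  have hx := hinj x (left_ne_zero_of_mul h0)
  have hy := hinj y (right_ne_zero_of_mul h0)
  unfold ScalesBy at *
  rw [map_mul] at hxy
  have h1 := Polynomial.natDegree_mul hx hy
  have h2 := Polynomial.natTrailingDegree_mul hx hy
  have hC : Polynomial.C (x * y) ≠ 0 := by simpa using h0
  rw [hxy, mul_comm, Polynomial.natDegree_mul_X_pow _ hC, Polynomial.natDegree_C] at h1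
  rw [hxy, mul_comm, Polynomial.natTrailingDegree_mul_X_pow hC, Polynomial.natTrailingDegree_C]
    at h2
  have h3 := Polynomial.natTrailingDegree_le_natDegree (σ x)
  have h4 := Polynomial.natTrailingDegree_le_natDegree (σ y)
  refine ⟨(σ x).natDegree, (σ y).natDegree, ?_, ?_, by omega⟩
  · have := eq_monomial_of_natDegree_eq_natTrailingDegree (p := σ x) (by omega)
    rwa [hσ x] at this
  · have := eq_monomial_of_natDegree_eq_natTrailingDegree (p := σ y) (by omega)
    rwa [hσ y] at this

variable {τ : Type*}

/-- The substitution `X i ↦ T * X i`. -/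
def gscale (τ S : Type*) [CommRing S] : MvPolynomial τ S →+* Polynomial (MvPolynomial τ S) :=
  eval₂Hom (Polynomial.C.comp C) fun i => Polynomial.X * Polynomial.C (X i)

theorem gscale_monomial (s : τ →₀ ℕ) (a : S) :
    gscale τ S (monomial s a) = Polynomial.X ^ s.degree * Polynomial.C (monomial s a) := by
  rw [gscale, coe_eval₂Hom, eval₂_monomial, monomial_eq]
  simp only [mul_pow, Finsupp.prod, Finset.prod_mul_distrib, RingHom.comp_apply, map_mul,
    map_prod, map_pow, Finset.prod_pow_eq_pow_sum, Finsupp.degree_apply]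
  ring

theorem coeff_gscale (P : MvPolynomial τ S) (e : ℕ) :
    (gscale τ S P).coeff e = homogeneousComponent e P := by
  induction P using MvPolynomial.induction_on' with
  | monomial s a =>
    rw [gscale_monomial, Polynomial.X_pow_mul_C, Polynomial.coeff_C_mul_X_pow,
      homogeneousComponent_of_mem (isHomogeneous_monomial a rfl)]
  | add p q hp hq => rw [map_add, Polynomial.coeff_add, hp, hq, map_add]

theorem eval_one_gscale (P : MvPolynomial τ S) : (gscale τ S P).eval 1 = P := by
  induction P using MvPolynomial.induction_on' with
  | monomial s a => simp [gscale_monomial]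
  | add p q hp hq => rw [map_add, Polynomial.eval_add, hp, hq]

theorem scalesBy_gscale_iff {P : MvPolynomial τ S} {d : ℕ} :
    ScalesBy (gscale τ S) d P ↔ P.IsHomogeneous d := by
  unfold ScalesBy
  constructor
  · intro h
    have := coeff_gscale P d
    rw [h, Polynomial.X_pow_mul_C, Polynomial.coeff_C_mul_X_pow, if_pos rfl] at this
    rw [this]
    exact homogeneousComponent_isHomogeneous d P
  · intro h
    ext1 e
    rw [coeff_gscale, Polynomial.X_pow_mul_C, Polynomial.coeff_C_mul_X_pow,
      homogeneousComponent_of_mem h]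

theorem isHomogeneous_of_mul [IsDomain S] {P Q : MvPolynomial τ S} {d : ℕ}
    (h : (P * Q).IsHomogeneous d) (h0 : P * Q ≠ 0) :
    ∃ e e', P.IsHomogeneous e ∧ Q.IsHomogeneous e' ∧ e + e' = d := by
  obtain ⟨e, e', h1, h2, h3⟩ :=
    ScalesBy.of_mul eval_one_gscale (scalesBy_gscale_iff.2 h) h0
  exact ⟨e, e', scalesBy_gscale_iff.1 h1, scalesBy_gscale_iff.1 h2, h3⟩

theorem exists_isHomogeneous_of_dvd [IsDomain S] {P Q : MvPolynomial τ S} {d : ℕ}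
    (hPQ : P ∣ Q) (h : Q.IsHomogeneous d) (h0 : Q ≠ 0) :
    ∃ e, P.IsHomogeneous e := by
  obtain ⟨R, rfl⟩ := hPQ
  obtain ⟨e, -, he, -⟩ := isHomogeneous_of_mul h h0
  exact ⟨e, he⟩

/-- For polynomials in `τ` over `MvPolynomial υ S`: the substitution scaling the inner variables. -/
def gscaleInner (τ υ S : Type*) [CommRing S] :
    MvPolynomial τ (MvPolynomial υ S) →+* Polynomial (MvPolynomial τ (MvPolynomial υ S)) :=
  eval₂Hom ((Polynomial.mapRingHom C).comp (gscale υ S)) fun j => Polynomial.C (X j)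

variable {υ : Type*}

theorem gscaleInner_monomial (s : τ →₀ ℕ) (a : MvPolynomial υ S) :
    gscaleInner τ υ S (monomial s a) =
      (gscale υ S a).map C * Polynomial.C (monomial s 1) := by
  rw [gscaleInner, coe_eval₂Hom, eval₂_monomial, monomial_eq]
  simp only [Finsupp.prod, RingHom.comp_apply, Polynomial.coe_mapRingHom, map_one, one_mul,
    map_prod, map_pow]

theorem coeff_coeff_gscaleInner (P : MvPolynomial τ (MvPolynomial υ S)) (e : ℕ) (k : τ →₀ ℕ) :
    coeff k ((gscaleInner τ υ S P).coeff e) = homogeneousComponent e (coeff k P) := by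
  induction P using MvPolynomial.induction_on' with
  | monomial s a =>
    classical
    rw [gscaleInner_monomial, Polynomial.coeff_mul_C, Polynomial.coeff_map, coeff_C_mul,
      coeff_gscale, coeff_monomial, coeff_monomial]
    split_ifs <;> simp
  | add p q hp hq => rw [map_add, Polynomial.coeff_add, coeff_add, hp, hq, coeff_add, map_add]

theorem eval_one_gscaleInner (P : MvPolynomial τ (MvPolynomial υ S)) :
    (gscaleInner τ υ S P).eval 1 = P := by
  induction P using MvPolynomial.induction_on' with
  | monomial s a =>
    have h : ((gscale υ S a).map (C : _ →+* MvPolynomial τ (MvPolynomial υ S))).eval 1 = C a := by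
      rw [Polynomial.eval_one_map, eval_one_gscale]
    rw [gscaleInner_monomial, Polynomial.eval_mul, h, Polynomial.eval_C, C_mul_monomial, mul_one]
  | add p q hp hq => rw [map_add, Polynomial.eval_add, hp, hq]

theorem scalesBy_gscaleInner_iff {P : MvPolynomial τ (MvPolynomial υ S)} {d : ℕ} :
    ScalesBy (gscaleInner τ υ S) d P ↔ ∀ k, (coeff k P).IsHomogeneous d := by
  unfold ScalesBy
  constructor
  · intro h k
    have := coeff_coeff_gscaleInner P d k
    rw [h, Polynomial.X_pow_mul_C, Polynomial.coeff_C_mul_X_pow, if_pos rfl] at this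
    rw [this]
    exact homogeneousComponent_isHomogeneous d _
  · intro h
    ext1 e
    ext1 k
    rw [coeff_coeff_gscaleInner, Polynomial.X_pow_mul_C, Polynomial.coeff_C_mul_X_pow,
      homogeneousComponent_of_mem (h k)]
    split_ifs <;> simp

end Grading

/-! ### Binary forms and their Sylvester resultants over a ring -/

section Forms

variable {D : Type*} [CommRing D]

theorem natDegree_dehomogenize_le {p : MvPolynomial (Fin 2) D} {d : ℕ} (hp : p.IsHomogeneous d) :
    (dehomogenize p).natDegree ≤ d := by
  unfold dehomogenize
  have := aeval_natDegree_le p hp.totalDegree_le ![(Polynomial.X : Polynomial D), 1] (n := 1) ?_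
  · simpa using this
  · intro i
    fin_cases i
    · simpa using Polynomial.natDegree_X_le
    · simp

theorem homogenize_dehomogenize {p : MvPolynomial (Fin 2) D} {d : ℕ} (hp : p.IsHomogeneous d) :
    (dehomogenize p).homogenize d = p :=
  Polynomial.homogenize_eq_of_isHomogeneous hp rfl

theorem dehomogenize_ne_zero {p : MvPolynomial (Fin 2) D} {d : ℕ} (hp : p.IsHomogeneous d)
    (h0 : p ≠ 0) : dehomogenize p ≠ 0 := by
  intro h
  apply h0
  rw [← homogenize_dehomogenize hp, h, Polynomial.homogenize_zero]

theorem dehomogenize_map {D' : Type*} [CommRing D'] (θ : D →+* D') (p : MvPolynomial (Fin 2) D) :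
    dehomogenize (map θ p) = (dehomogenize p).map θ := by
  induction p using MvPolynomial.induction_on with
  | C a => simp [dehomogenize]
  | add p q hp hq =>
    have e : ∀ p q : MvPolynomial (Fin 2) D, dehomogenize (p + q) = dehomogenize p + dehomogenize q :=
      fun p q => map_add _ p q
    have e' : ∀ p q : MvPolynomial (Fin 2) D',
      dehomogenize (p + q) = dehomogenize p + dehomogenize q := fun p q => map_add _ p q
    rw [map_add, e', hp, hq, e, Polynomial.map_add]
  | mul_X p i hp =>
    have e : ∀ p q : MvPolynomial (Fin 2) D, dehomogenize (p * q) = dehomogenize p * dehomogenize q :=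
      fun p q => map_mul _ p q
    have e' : ∀ p q : MvPolynomial (Fin 2) D',
      dehomogenize (p * q) = dehomogenize p * dehomogenize q := fun p q => map_mul _ p q
    rw [map_mul, e', hp, e, Polynomial.map_mul, map_X]
    congr 1
    fin_cases i <;> simp [dehomogenize]

theorem eval_eq_eval_dehomogenize {L : Type*} [Field L] {p : MvPolynomial (Fin 2) L} {d : ℕ}
    (hp : p.IsHomogeneous d) (x : Fin 2 → L) (hx : x 1 ≠ 0) :
    eval x p = (dehomogenize p).eval (x 0 / x 1) * x 1 ^ d := by
  rw [← Polynomial.eval_homogenize (natDegree_dehomogenize_le hp) x hx, homogenize_dehomogenize hp]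

/-- The resultant of two binary forms, not both constant, vanishes if these have a common zero. -/
theorem map_resultant_eq_zero_of_common_zero {D' : Type*} [CommRing D'] [IsDomain D']
    (θ : D →+* D') {p q : MvPolynomial (Fin 2) D} {d e : ℕ} (hp : p.IsHomogeneous d)
    (hq : q.IsHomogeneous e) (hde : d ≠ 0 ∨ e ≠ 0) (x : Fin 2 → D') (hx : x 1 ≠ 0)
    (hpx : eval₂ θ x p = 0) (hqx : eval₂ θ x q = 0) :
    θ (Polynomial.resultant (dehomogenize p) (dehomogenize q) d e) = 0 := by
  let L := FractionRing D'
  let j : D' →+* L := algebraMap D' L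
  have hj : Function.Injective j := IsFractionRing.injective D' L
  have hroot : ∀ {r : MvPolynomial (Fin 2) D} {k : ℕ}, r.IsHomogeneous k → eval₂ θ x r = 0 →
      (dehomogenize r).eval₂ (j.comp θ) (j (x 0) / j (x 1)) = 0 := by
    intro r k hr h
    have h1 : eval (j ∘ x) (map (j.comp θ) r) = 0 := by
      rw [eval_map, ← eval₂_comp_left, h, map_zero]
    have hx1 : (j ∘ x) 1 ≠ 0 := by
      simpa using (map_ne_zero_iff j hj).2 hx
    rw [eval_eq_eval_dehomogenize (hr.map _) _ hx1, dehomogenize_map] at h1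
    rw [← Polynomial.eval_map]
    exact (mul_eq_zero.1 h1).resolve_right (pow_ne_zero _ hx1)
  -- The resultant lies in the ideal of the two polynomials, so it dies at the common root `x₀ / x₁`
  -- in the fraction field. Degrees `d = e = 0` are excluded because the empty determinant is `1`.
  obtain ⟨u, v, -, -, huv⟩ := Polynomial.exists_mul_add_mul_eq_C_resultant (dehomogenize p)
    (dehomogenize q) (natDegree_dehomogenize_le hp) (natDegree_dehomogenize_le hq) hde
  have h2 := congrArg (Polynomial.eval₂ (j.comp θ) (j (x 0) / j (x 1))) huv
  rw [Polynomial.eval₂_add, Polynomial.eval₂_mul, Polynomial.eval₂_mul, hroot hp hpx,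
    hroot hq hqx, Polynomial.eval₂_C, zero_mul, zero_mul, add_zero] at h2
  exact hj (by rw [map_zero]; exact h2.symm)

/-- The Sylvester matrix represents `(u, v) ↦ p v + q u` in monomial bases; a vanishing determinant
gives a kernel vector. -/
theorem exists_relation_of_resultant_eq_zero [IsDomain D] {p q : Polynomial D} {d e : ℕ}
    (hp : p.natDegree ≤ d) (hq : q.natDegree ≤ e) (h : Polynomial.resultant p q d e = 0) :
    ∃ u v : Polynomial D, u.degree < d ∧ v.degree < e ∧ p * v + q * u = 0 ∧ (u ≠ 0 ∨ v ≠ 0) := by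
  let b₁ := ((Polynomial.degreeLT.basis D d).prod (Polynomial.degreeLT.basis D e)).reindex
    finSumFinEquiv
  let b₂ := Polynomial.degreeLT.basis D (d + e)
  obtain ⟨w, hw0, hw⟩ := Matrix.exists_mulVec_eq_zero_iff.2 h
  rw [← Polynomial.toMatrix_sylvesterMap' p q hp hq] at hw
  let z := b₁.equivFun.symm w
  have hz : Polynomial.sylvesterMap p q hp hq z = 0 := by
    apply b₂.repr.injective
    have h1 := LinearMap.toMatrix_mulVec_repr b₁ b₂ (Polynomial.sylvesterMap p q hp hq) z
    have h2 : (b₁.repr z : Fin (d + e) → D) = w := by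
      rw [← Module.Basis.equivFun_apply]
      exact LinearEquiv.apply_symm_apply _ _
    rw [h2] at h1
    ext i
    rw [← h1, map_zero]
    exact congrFun hw i
  have hz0 : z ≠ 0 := by
    simpa only [z, Ne, LinearEquiv.map_eq_zero_iff] using hw0
  refine ⟨z.1, z.2, Polynomial.mem_degreeLT.1 z.1.2, Polynomial.mem_degreeLT.1 z.2.2, ?_, ?_⟩
  · exact congrArg Subtype.val hz
  · by_contra! hcon
    exact hz0 (Prod.ext (Subtype.ext hcon.1) (Subtype.ext hcon.2))

/-- The resultant of two relatively prime binary forms does not vanish. -/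
theorem resultant_ne_zero_of_isRelPrime [IsDomain D] [DecompositionMonoid (MvPolynomial (Fin 2) D)]
    {p q : MvPolynomial (Fin 2) D} {d e : ℕ} (hp : p.IsHomogeneous d) (hq : q.IsHomogeneous e)
    (hp0 : p ≠ 0) (hq0 : q ≠ 0) (hpq : IsRelPrime p q) :
    Polynomial.resultant (dehomogenize p) (dehomogenize q) d e ≠ 0 := by
  intro h
  obtain ⟨u, v, hu, hv, huv, hne⟩ := exists_relation_of_resultant_eq_zero
    (natDegree_dehomogenize_le hp) (natDegree_dehomogenize_le hq) h
  have hp1 := dehomogenize_ne_zero hp hp0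
  have hq1 := dehomogenize_ne_zero hq hq0
  have hu0 : u ≠ 0 := by
    rintro rfl
    rw [mul_zero, add_zero] at huv
    rcases mul_eq_zero.1 huv with h | h
    · exact hp1 h
    · simp [h] at hne
  have hv0 : v ≠ 0 := by
    rintro rfl
    rw [mul_zero, zero_add] at huv
    rcases mul_eq_zero.1 huv with h | h
    · exact hq1 h
    · simp [h] at hne
  rw [← Polynomial.natDegree_lt_iff_degree_lt hu0] at hu
  rw [← Polynomial.natDegree_lt_iff_degree_lt hv0] at hv
  -- Homogenized in degree `d + e - 1`, the relation makes `p` divide a nonzero form of degree `d -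
  -- 1`. Since `u` and `v` are nonzero of degree below `d` and `e`, both `d` and `e` are positive
  -- and nothing is truncated.
  have h1 := congrArg (fun r => Polynomial.homogenize r (d + (e - 1))) huv
  simp only [Polynomial.homogenize_add, Polynomial.homogenize_zero] at h1
  rw [Polynomial.homogenize_mul _ _ (natDegree_dehomogenize_le hp) (by omega),
    show d + (e - 1) = e + (d - 1) by omega,
    Polynomial.homogenize_mul _ _ (natDegree_dehomogenize_le hq) (by omega),
    homogenize_dehomogenize hp, homogenize_dehomogenize hq] at h1
  have h2 : p ∣ u.homogenize (d - 1) := by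
    apply hpq.dvd_of_dvd_mul_left
    exact ⟨-v.homogenize (e - 1), by linear_combination h1⟩
  obtain ⟨r, hr⟩ := h2
  have hU0 : u.homogenize (d - 1) ≠ 0 := by
    rw [Ne, Polynomial.homogenize_eq_zero_iff (by omega)]
    exact hu0
  have hU := (Polynomial.isHomogeneous_homogenize (n := d - 1) u)
  rw [hr] at hU hU0
  obtain ⟨k, k', hk, -, hkk⟩ := isHomogeneous_of_mul hU hU0
  have := hk.inj_right hp hp0
  omega

theorem isRelPrime_of_prime_of_not_dvd {p q : D} [IsDomain D] (hp : Prime p) (h : ¬ p ∣ q) :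
    IsRelPrime p q := by
  intro r hr hr'
  obtain ⟨s, hs⟩ := hr
  rcases hp.irreducible.isUnit_or_isUnit hs with h1 | h1
  · exact h1
  · exact absurd ((hs ▸ (h1.mul_right_dvd.2 dvd_rfl : r * s ∣ r)).trans hr') h

/-- The resultant with respect to the outer variables of polynomials whose coefficients have
constant degree for a grading has constant degree for this grading. -/
theorem ScalesBy.resultant {σ : D →+* Polynomial D} {a b d e : ℕ}
    {p q : MvPolynomial (Fin 2) D} (hp : ∀ k, ScalesBy σ a (coeff k p))
    (hq : ∀ k, ScalesBy σ b (coeff k q)) :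
    ScalesBy σ (a * e + b * d)
      (Polynomial.resultant (dehomogenize p) (dehomogenize q) d e) := by
  have key : ∀ {r : MvPolynomial (Fin 2) D} {c : ℕ}, (∀ k, ScalesBy σ c (coeff k r)) →
      (dehomogenize r).map σ =
        Polynomial.C (Polynomial.X ^ c) * (dehomogenize r).map Polynomial.C := by
    intro r c hr
    rw [← dehomogenize_map, ← dehomogenize_map]
    have : map σ r = C (Polynomial.X ^ c) * map Polynomial.C r := by
      ext1 k
      rw [coeff_map, coeff_C_mul, coeff_map]
      exact hr k
    rw [this]
    simp [dehomogenize]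
  unfold ScalesBy
  -- The resultant has degree `e` in the coefficients of `p` and `d` in those of `q`.
  rw [← Polynomial.resultant_map_map, key hp, key hq, Polynomial.resultant_C_mul_left,
    Polynomial.resultant_C_mul_right, Polynomial.resultant_map_map]
  ring

end Forms

/-! ### Zeros of binary forms over a field -/

section FormsField

variable {K : Type*} [Field K]

theorem exists_zero_of_isHomogeneous [IsAlgClosed K] {q : Bin K} {e : ℕ} (hq : q.IsHomogeneous e)
    (he : e ≠ 0) : ∃ x : Fin 2 → K, x ≠ 0 ∧ eval x q = 0 := by
  by_cases h : (dehomogenize q).natDegree = 0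
  -- A constant dehomogenization means a constant multiple of the `e`-th power of the second
  -- variable, which vanishes at infinity.
  · refine ⟨![1, 0], fun h => by simpa using congrFun h 0, ?_⟩
    rw [← homogenize_dehomogenize hq, Polynomial.eq_C_of_natDegree_eq_zero h,
      Polynomial.homogenize_C]
    simp [he]
  · obtain ⟨r, hr⟩ := IsAlgClosed.exists_root (dehomogenize q)
      (fun h' => h (Polynomial.natDegree_eq_of_degree_eq_some h'))
    refine ⟨![r, 1], fun h => by simpa using congrFun h 1, ?_⟩
    rw [eval_eq_eval_dehomogenize hq _ (by simp)]
    simp only [Matrix.cons_val_zero, Matrix.cons_val_one, div_one, one_pow, mul_one]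
    exact hr

theorem not_isUnit_of_isHomogeneous {q : Bin K} {e : ℕ} (hq : q.IsHomogeneous e)
    (he : e ≠ 0) : ¬ IsUnit q := by
  intro h
  have h1 := h.map (constantCoeff (σ := Fin 2) (R := K))
  have h2 : constantCoeff q = 0 := hq.coeff_eq_zero (by simpa using he.symm)
  rw [h2] at h1
  simp at h1

/-- Two binary forms with vanishing resultant have a common zero. -/
theorem exists_common_zero_of_resultant_eq_zero [IsAlgClosed K] {p q : Bin K} {d e : ℕ}
    (hp : p.IsHomogeneous d) (hq : q.IsHomogeneous e) (hd : d ≠ 0) (he : e ≠ 0)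
    (h : Polynomial.resultant (dehomogenize p) (dehomogenize q) d e = 0) :
    ∃ x : Fin 2 → K, x ≠ 0 ∧ eval x p = 0 ∧ eval x q = 0 := by
  by_cases hp0 : p = 0
  · obtain ⟨x, hx, hx'⟩ := exists_zero_of_isHomogeneous hq he
    exact ⟨x, hx, by simp [hp0], hx'⟩
  by_cases hq0 : q = 0
  · obtain ⟨x, hx, hx'⟩ := exists_zero_of_isHomogeneous hp hd
    exact ⟨x, hx, hx', by simp [hq0]⟩
  have hrel : ¬ IsRelPrime p q := fun hr => resultant_ne_zero_of_isRelPrime hp hq hp0 hq0 hr h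
  unfold IsRelPrime at hrel
  push Not at hrel
  obtain ⟨r, hrp, hrq, hr⟩ := hrel
  obtain ⟨k, hk⟩ := exists_isHomogeneous_of_dvd hrp hp hp0
  have hk0 : k ≠ 0 := by
    rintro rfl
    rw [← totalDegree_zero_iff_isHomogeneous, totalDegree_eq_zero_iff_eq_C] at hk
    rw [hk] at hr hrp
    apply hr
    refine (isUnit_iff_ne_zero.2 fun h0 => ?_).map C
    rw [h0, map_zero, zero_dvd_iff] at hrp
    exact hp0 hrp
  obtain ⟨x, hx, hx'⟩ := exists_zero_of_isHomogeneous hk hk0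
  refine ⟨x, hx, ?_, ?_⟩
  · obtain ⟨c, rfl⟩ := hrp
    simp [hx']
  · obtain ⟨c, rfl⟩ := hrq
    simp [hx']

/-- The linear form vanishing at the point `x` of the projective line. -/
def pointForm (x : Fin 2 → K) : Bin K := C (x 1) * X 0 - C (x 0) * X 1

theorem eval_pointForm_self (x : Fin 2 → K) : eval x (pointForm x) = 0 := by
  simp [pointForm, mul_comm]

theorem isHomogeneous_pointForm (x : Fin 2 → K) : (pointForm x).IsHomogeneous 1 :=
  (isHomogeneous_C_mul_X _ _).sub (isHomogeneous_C_mul_X _ _)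

theorem pointForm_ne_zero {x : Fin 2 → K} (hx : x ≠ 0) : pointForm x ≠ 0 := by
  intro h
  apply hx
  have h0 := congrArg (eval ![1, 0]) h
  have h1 := congrArg (eval ![0, 1]) h
  simp [pointForm] at h0 h1
  funext i
  fin_cases i
  · exact h1
  · exact h0

theorem aeval_smul_of_isHomogeneous {τ A : Type*} [CommRing A] [Algebra K A]
    {F : MvPolynomial τ K} {d : ℕ} (hF : F.IsHomogeneous d) (c : A) (z : τ → A) :
    aeval (fun i => c * z i) F = c ^ d * aeval z F := by
  rw [aeval_def, aeval_def, eval₂_eq, eval₂_eq, Finset.mul_sum]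
  refine Finset.sum_congr rfl fun s hs => ?_
  rw [hF.degree_eq_sum_deg_support hs, ← Finset.prod_pow_eq_pow_sum]
  simp only [mul_pow, Finset.prod_mul_distrib]
  ring

theorem eval_smul_of_isHomogeneous {τ : Type*} {F : MvPolynomial τ K} {d : ℕ}
    (hF : F.IsHomogeneous d) (c : K) (z : τ → K) : eval (c • z) F = c ^ d * eval z F :=
  aeval_smul_of_isHomogeneous hF c z

/-- Modulo the linear form, `xᵢ Xⱼ = xⱼ Xᵢ`, so `xᵢ^d F(X) = F(Xᵢ x) = Xᵢ^d F(x) = 0`, and some `xᵢ`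
is a unit. -/
theorem pointForm_dvd {F : Bin K} {d : ℕ} (hF : F.IsHomogeneous d) {x : Fin 2 → K} (hx : x ≠ 0)
    (h : eval x F = 0) : pointForm x ∣ F := by
  let I := Ideal.span {pointForm x}
  let π := Ideal.Quotient.mk I
  have hℓ : π (C (x 1) * X 0) = π (C (x 0) * X 1) := by
    rw [Ideal.Quotient.eq]
    exact Ideal.mem_span_singleton_self _
  have hmk : ∀ G : Bin K, aeval (fun i => π (X i)) G = π G := by
    intro G
    have := (aeval_unique (Ideal.Quotient.mkₐ K I))
    exact (DFunLike.congr_fun this G).symm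
  have hpt : ∀ c : Bin K ⧸ I, aeval (fun i => c * algebraMap K (Bin K ⧸ I) (x i)) F = 0 := by
    intro c
    rw [aeval_smul_of_isHomogeneous hF]
    have : aeval (fun i => algebraMap K (Bin K ⧸ I) (x i)) F
        = algebraMap K (Bin K ⧸ I) (eval x F) := by
      have := eval₂_comp_left (algebraMap K (Bin K ⧸ I)) (RingHom.id K) x F
      rw [RingHom.comp_id] at this
      exact this.symm
    rw [this, h, map_zero, mul_zero]
  have key : ∀ i j : Fin 2, π (C (x i) * X j) = π (C (x j) * X i) := by
    intro i j
    fin_cases i <;> fin_cases j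
    · rfl
    · exact hℓ.symm
    · exact hℓ
    · rfl
  obtain ⟨i, hi⟩ := Function.ne_iff.1 hx
  have h1 : (π (C (x i))) ^ d * π F = 0 := by
    rw [← hpt (π (X i)), ← hmk F, ← aeval_smul_of_isHomogeneous hF]
    congr 2
    funext j
    rw [← map_mul, key, map_mul, mul_comm]
    rfl
  have h2 : IsUnit (π (C (x i)) ^ d) :=
    (((isUnit_iff_ne_zero.2 hi).map C).map π).pow d
  rw [h2.mul_right_eq_zero, Ideal.Quotient.eq_zero_iff_mem, Ideal.mem_span_singleton] at h1
  exact h1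

end FormsField

/-! ### Syzygies of the curve `f`, globally and at a point -/

section Syzygies

variable {K : Type*} [Field K] {f : Fin 4 → Bin K} {m : ℕ} {μ : Fin 3 → ℕ}
  {φ : Matrix (Fin 4) (Fin 3) (Bin K)}

theorem eq_C_of_isHomogeneous_zero {τ S : Type*} [CommRing S] {p : MvPolynomial τ S}
    (hp : p.IsHomogeneous 0) : p = C (constantCoeff p) := by
  rw [← totalDegree_zero_iff_isHomogeneous, totalDegree_eq_zero_iff_eq_C] at hp
  exact hp

theorem IsSyzygyMatrix.sum_mul_eq_zero (hφ : IsSyzygyMatrix f μ φ) (j : Fin 3) :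
    ∑ i, f i * φ i j = 0 := by
  have : (fun i => φ i j) ∈ syzygies f := by
    rw [← hφ.span_eq]
    exact Submodule.subset_span ⟨j, rfl⟩
  exact this

theorem IsSyzygyMatrix.exists_combination (hφ : IsSyzygyMatrix f μ φ) {a : Fin 4 → Bin K}
    (ha : ∑ i, f i * a i = 0) : ∃ r : Fin 3 → Bin K, ∀ i, a i = ∑ j, r j * φ i j := by
  have : a ∈ Submodule.span (Bin K) (Set.range fun j i => φ i j) := by
    rw [hφ.span_eq]
    exact ha
  obtain ⟨r, hr⟩ := (Submodule.mem_span_range_iff_exists_fun _).1 this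
  refine ⟨r, fun i => ?_⟩
  rw [← hr, Finset.sum_apply]
  rfl

theorem IsSyzygyMatrix.eq_zero_of_combination (hφ : IsSyzygyMatrix f μ φ) {r : Fin 3 → Bin K}
    (h : ∀ i, ∑ j, r j * φ i j = 0) : r = 0 := by
  funext j
  refine Fintype.linearIndependent_iff.1 hφ.linearIndependent r ?_ j
  funext i
  rw [Finset.sum_apply]
  exact h i

theorem finrank_ker_linearCombination
    (hdim : Module.finrank K (Submodule.span K (Set.range f)) = 3) :
    Module.finrank K (LinearMap.ker (Fintype.linearCombination K f)) = 1 := by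
  have h := LinearMap.finrank_range_add_finrank_ker (Fintype.linearCombination K f)
  rw [Fintype.range_linearCombination, hdim, Module.finrank_fin_fun] at h
  omega

theorem mem_ker_linearCombination_iff {c : Fin 4 → K} :
    c ∈ LinearMap.ker (Fintype.linearCombination K f) ↔ ∑ i, f i * C (c i) = 0 := by
  rw [LinearMap.mem_ker, Fintype.linearCombination_apply]
  simp only [smul_eq_C_mul, mul_comm]

/-- A nonzero constant syzygy exists by rank-nullity; columns of positive degree generate only
vectors without constant term. -/
theorem IsSyzygyMatrix.degree_zero (hφ : IsSyzygyMatrix f μ φ)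
    (hdim : Module.finrank K (Submodule.span K (Set.range f)) = 3) : μ 0 = 0 := by
  by_contra h0
  obtain ⟨⟨c, hc⟩, hc0, -⟩ := finrank_eq_one_iff'.1 (finrank_ker_linearCombination hdim)
  obtain ⟨r, hr⟩ := hφ.exists_combination (mem_ker_linearCombination_iff.1 hc)
  apply hc0
  ext i
  have h1 := congrArg constantCoeff (hr i)
  rw [constantCoeff_C, map_sum] at h1
  refine h1.trans (Finset.sum_eq_zero fun j _ => ?_)
  have h2 : constantCoeff (φ i j) = 0 := by
    refine (hφ.isHomogeneous i j).coeff_eq_zero ?_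
    have := hφ.monotone (Fin.zero_le j)
    simp only [map_zero]
    omega
  rw [map_mul, h2, mul_zero]

/-- The constant syzygies form a line, so two constant columns would be dependent. -/
theorem IsSyzygyMatrix.degree_one_ne_zero (hφ : IsSyzygyMatrix f μ φ)
    (hdim : Module.finrank K (Submodule.span K (Set.range f)) = 3) : μ 1 ≠ 0 := by
  intro h1
  have h0 := hφ.degree_zero hdim
  have hC0 : ∀ i, φ i 0 = C (constantCoeff (φ i 0)) := fun i =>
    eq_C_of_isHomogeneous_zero (h0 ▸ hφ.isHomogeneous i 0)
  have hC1 : ∀ i, φ i 1 = C (constantCoeff (φ i 1)) := fun i =>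
    eq_C_of_isHomogeneous_zero (h1 ▸ hφ.isHomogeneous i 1)
  have m0 : (fun i => constantCoeff (φ i 0)) ∈ LinearMap.ker (Fintype.linearCombination K f) := by
    rw [mem_ker_linearCombination_iff, ← hφ.sum_mul_eq_zero 0]
    exact Finset.sum_congr rfl fun i _ => by rw [← hC0]
  have m1 : (fun i => constantCoeff (φ i 1)) ∈ LinearMap.ker (Fintype.linearCombination K f) := by
    rw [mem_ker_linearCombination_iff, ← hφ.sum_mul_eq_zero 1]
    exact Finset.sum_congr rfl fun i _ => by rw [← hC1]
  obtain ⟨⟨c, hc⟩, hc0, hcs⟩ := finrank_eq_one_iff'.1 (finrank_ker_linearCombination hdim)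
  obtain ⟨α, hα⟩ := hcs ⟨_, m0⟩
  obtain ⟨β, hβ⟩ := hcs ⟨_, m1⟩
  have hα' : ∀ i, φ i 0 = C (α * c i) := fun i => by
    rw [hC0]; exact congrArg C (congrFun (congrArg Subtype.val hα) i).symm
  have hβ' : ∀ i, φ i 1 = C (β * c i) := fun i => by
    rw [hC1]; exact congrArg C (congrFun (congrArg Subtype.val hβ) i).symm
  have h3 := hφ.eq_zero_of_combination (r := ![C β, -C α, 0]) fun i => by
    rw [Fin.sum_univ_three]
    simp only [hα', hβ', Matrix.cons_val_zero, Matrix.cons_val_one, Matrix.cons_val, map_mul]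
    ring
  have hα0 : α = 0 := by
    have := congrFun h3 1
    simpa using this
  have h4 := hφ.eq_zero_of_combination (r := ![1, 0, 0]) fun i => by
    rw [Fin.sum_univ_three]
    simp [hα', hα0]
  simpa using congrFun h4 0

/-- The columns of a syzygy matrix are primitive. -/
theorem IsSyzygyMatrix.isUnit_of_dvd_column (hφ : IsSyzygyMatrix f μ φ)  {j : Fin 3}
    {e : Bin K} (he : ∀ i, e ∣ φ i j) : IsUnit e := by
  choose w hw using he
  have he0 : e ≠ 0 := by
    rintro rfl
    have := hφ.eq_zero_of_combination (r := Pi.single j 1) fun i => by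
      simp [Pi.single_apply, hw i]
    simpa using congrFun this j
  -- The column divided by `e` is still a syzygy, hence a combination of the columns with
  -- coefficients `r`; uniqueness of coordinates gives `e * r j = 1`.
  have hsyz : ∑ i, f i * w i = 0 := by
    have h := hφ.sum_mul_eq_zero j
    simp only [hw, mul_left_comm _ e, ← Finset.mul_sum] at h
    exact (mul_eq_zero.1 h).resolve_left he0
  obtain ⟨r, hr⟩ := hφ.exists_combination hsyz
  have := hφ.eq_zero_of_combination (r := fun k => (if k = j then 1 else 0) - e * r k)
    fun i => by
      have h1 : ∑ k, (if k = j then (1 : Bin K) else 0) * φ i k = φ i j := by simp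
      have h2 : ∑ k, e * r k * φ i k = φ i j := by
        rw [hw, hr, Finset.mul_sum]
        exact Finset.sum_congr rfl fun k _ => mul_assoc _ _ _
      simp only [sub_mul, Finset.sum_sub_distrib]
      rw [h1, h2, sub_self]
  have h1 := congrFun this j
  simp only [if_true, Pi.zero_apply, sub_eq_zero] at h1
  exact IsUnit.of_mul_eq_one _ h1.symm

theorem not_isUnit_pointForm (x : Fin 2 → K) : ¬ IsUnit (pointForm x) :=
  not_isUnit_of_isHomogeneous (isHomogeneous_pointForm x) one_ne_zero

/-- The columns of a syzygy matrix are linearly independent at every point. -/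
theorem IsSyzygyMatrix.linearIndependent_eval (hφ : IsSyzygyMatrix f μ φ) {p : Fin 2 → K}
    (hp : p ≠ 0) {α : Fin 3 → K} (h : ∀ i, ∑ j, α j * eval p (φ i j) = 0) : α = 0 := by
  obtain ⟨k, hk⟩ := Function.ne_iff.1 hp
  let l : Bin K := C (p k)⁻¹ * X k
  have hl : eval p l = 1 := by
    simp [l, inv_mul_cancel₀ hk]
  have hlh : l.IsHomogeneous 1 := isHomogeneous_C_mul_X _ _
  -- Powers of `l`, which has value `1` at `p`, bring all terms to degree `μ 2`. The combination
  -- vanishes at `p`, so it is `pointForm p` times a syzygy; comparing coordinates, `pointForm p`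
  -- divides every `r j`, whose value at `p` is `α j`.
  let r : Fin 3 → Bin K := fun j => C (α j) * l ^ (μ 2 - μ j)
  have hr : ∀ j, eval p (r j) = α j := fun j => by simp [r, hl]
  have hdvd : ∀ i, pointForm p ∣ ∑ j, r j * φ i j := by
    intro i
    have hh : (∑ j, r j * φ i j).IsHomogeneous (μ 2) := by
      refine IsHomogeneous.sum _ _ _ fun j _ => ?_
      have := ((hlh.pow (μ 2 - μ j)).C_mul (α j)).mul (hφ.isHomogeneous i j)
      have hle : μ j ≤ μ 2 := hφ.monotone (Fin.le_last j)
      rwa [one_mul, Nat.sub_add_cancel hle] at this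
    refine pointForm_dvd hh hp ?_
    simp only [map_sum, map_mul, hr]
    exact h i
  choose w hw using hdvd
  have hsyz : ∑ i, f i * w i = 0 := by
    have h1 : pointForm p * ∑ i, f i * w i = 0 := by
      simp only [Finset.mul_sum, mul_left_comm (pointForm p), ← hw]
      rw [Finset.sum_comm]
      refine Finset.sum_eq_zero fun j _ => ?_
      simp only [mul_left_comm _ (r j), ← Finset.mul_sum, hφ.sum_mul_eq_zero, mul_zero]
    exact (mul_eq_zero.1 h1).resolve_left (pointForm_ne_zero hp)
  obtain ⟨c, hc⟩ := hφ.exists_combination hsyz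
  have h2 := hφ.eq_zero_of_combination (r := fun j => r j - pointForm p * c j) fun i => by
    simp only [sub_mul, Finset.sum_sub_distrib, mul_assoc, ← Finset.mul_sum, ← hc, hw, sub_self]
  funext j
  have h3 := congrArg (eval p) (congrFun h2 j)
  simpa [hr, eval_pointForm_self] using h3

theorem exists_eval_ne_zero (hf : ∀ i, (f i).IsHomogeneous m) (hgcd : IsGCDOf 1 f)
    {p : Fin 2 → K} (hp : p ≠ 0) : (fun i => eval p (f i)) ≠ 0 := by
  intro h
  exact not_isUnit_pointForm p
    (isUnit_of_dvd_one (hgcd.2 _ fun i => pointForm_dvd (hf i) hp (congrFun h i)))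

/-- The vectors orthogonal to the syzygies at a point are the multiples of the value of `f`. -/
theorem IsSyzygyMatrix.exists_smul_eq (hφ : IsSyzygyMatrix f μ φ)
    (hf : ∀ i, (f i).IsHomogeneous m) (hgcd : IsGCDOf 1 f) {p : Fin 2 → K} (hp : p ≠ 0)
    {P : Fin 4 → K} (hP : ∀ j, ∑ i, eval p (φ i j) * P i = 0) :
    ∃ c : K, c • (fun i => eval p (f i)) = P := by
  let M : Matrix (Fin 3) (Fin 4) K := fun j i => eval p (φ i j)
  have hM : LinearIndependent K M.row := by
    rw [Fintype.linearIndependent_iff]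
    intro α hα j
    refine congrFun (hφ.linearIndependent_eval hp (α := α) fun i => ?_) j
    have := congrFun hα i
    rw [Finset.sum_apply] at this
    exact this
  have hrank : Module.finrank K (LinearMap.range M.mulVecLin) = 3 := by
    have := hM.rank_matrix
    rwa [Fintype.card_fin] at this
  -- Rank 3 leaves a line as kernel, and it contains the nonzero vector `f(p)`.
  have hker : Module.finrank K (LinearMap.ker M.mulVecLin) = 1 := by
    have h := LinearMap.finrank_range_add_finrank_ker M.mulVecLin
    rw [hrank, Module.finrank_fin_fun] at h
    omega
  have hmem : ∀ Q : Fin 4 → K, Q ∈ LinearMap.ker M.mulVecLin ↔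
      ∀ j, ∑ i, eval p (φ i j) * Q i = 0 := by
    intro Q
    rw [LinearMap.mem_ker, Matrix.mulVecLin_apply, funext_iff]
    rfl
  have hv : (fun i => eval p (f i)) ∈ LinearMap.ker M.mulVecLin := by
    rw [hmem]
    intro j
    have := congrArg (eval p) (hφ.sum_mul_eq_zero j)
    simpa [mul_comm] using this
  have hv0 : (⟨_, hv⟩ : LinearMap.ker M.mulVecLin) ≠ 0 := fun h =>
    exists_eval_ne_zero hf hgcd hp (congrArg Subtype.val h)
  obtain ⟨c, hc⟩ := (finrank_eq_one_iff_of_nonzero' _ hv0).1 hker ⟨P, (hmem P).2 hP⟩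
  exact ⟨c, congrArg Subtype.val hc⟩

/-- A plane is not covered by a curve that is not contained in the plane `x₀ = 0`. -/
theorem exists_orthogonal_forall_smul_ne [Infinite K] (hf : ∀ i, (f i).IsHomogeneous m)
    (hf0 : f 0 ≠ 0) (a : Fin 4 → K) : ∃ P : Fin 4 → K, ∑ i, a i * P i = 0 ∧
      ∀ p : Fin 2 → K, p ≠ 0 → ∀ c : K, c • (fun i => eval p (f i)) ≠ P := by
  classical
  -- The vectors of the plane with zeroth coordinate `0` form a space of dimension at least 2, so
  -- the pencil `w₁ + x w₂` has infinitely many directions in it. A curve point in one of these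
  -- directions sits over a zero of `f 0`, and there are only finitely many of those.
  let M : Matrix (Fin 2) (Fin 4) K := ![Pi.single 0 1, a]
  have hker : 1 < Module.finrank K (LinearMap.ker M.mulVecLin) := by
    have h := LinearMap.finrank_range_add_finrank_ker M.mulVecLin
    have h' := Submodule.finrank_le (LinearMap.range M.mulVecLin)
    rw [Module.finrank_fin_fun] at h h'
    omega
  have hmem : ∀ w : LinearMap.ker M.mulVecLin,
      (w : Fin 4 → K) 0 = 0 ∧ ∑ i, a i * (w : Fin 4 → K) i = 0 := by
    rintro ⟨w, hw⟩
    rw [LinearMap.mem_ker, Matrix.mulVecLin_apply] at hw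
    refine ⟨?_, congrFun hw 1⟩
    have := congrFun hw 0
    simpa [M, Matrix.mulVec, dotProduct, Pi.single_apply] using this
  have : Nontrivial (LinearMap.ker M.mulVecLin) :=
    Module.nontrivial_of_finrank_pos (R := K) (by omega)
  obtain ⟨w₁, hw₁⟩ := exists_ne (0 : LinearMap.ker M.mulVecLin)
  obtain ⟨w₂, hw⟩ := exists_linearIndependent_pair_of_one_lt_finrank hker hw₁
  rw [LinearIndependent.pair_iff] at hw
  by_contra! hcon
  let Q : K → LinearMap.ker M.mulVecLin := fun x => w₁ + x • w₂
  have hQ : ∀ x, ∃ p : Fin 2 → K, p ≠ 0 ∧ ∃ c : K, c • (fun i => eval p (f i)) = (Q x).1 :=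
    fun x => hcon _ (hmem (Q x)).2
  choose p hp c hc using hQ
  have hc0 : ∀ x, c x ≠ 0 := by
    intro x h
    have h1 : (Q x) = 0 := Subtype.ext (by rw [← hc, h, zero_smul]; rfl)
    have := (hw 1 x (by rw [one_smul]; exact h1)).1
    exact one_ne_zero this
  have hroot : ∀ x, eval (p x) (f 0) = 0 := by
    intro x
    have h1 := congrFun (hc x) 0
    rw [(hmem (Q x)).1] at h1
    exact (mul_eq_zero.1 h1).resolve_left (hc0 x)
  -- The point of the projective line given by `p x`, with `none` for infinity.
  let cls : K → Option K := fun x => if p x 1 = 0 then none else some (p x 0 / p x 1)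
  have hfin : (Set.range cls).Finite := by
    refine Set.Finite.subset ((((dehomogenize (f 0)).roots.toFinset.finite_toSet).image
      some).insert none) ?_
    rintro _ ⟨x, rfl⟩
    by_cases h : p x 1 = 0
    · left
      simp [cls, h]
    · right
      refine ⟨p x 0 / p x 1, ?_, by simp [cls, h]⟩
      have h1 := hroot x
      rw [eval_eq_eval_dehomogenize (hf 0) _ h] at h1
      have h2 := (mul_eq_zero.1 h1).resolve_right (pow_ne_zero _ h)
      simpa using ⟨dehomogenize_ne_zero (hf 0) hf0, h2⟩
  obtain ⟨x, -, y, -, hxy, hcls⟩ :=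
    (Set.infinite_univ (α := K)).exists_ne_map_eq_of_mapsTo
      (f := cls) (t := Set.range cls) (fun x _ => ⟨x, rfl⟩) hfin
  have hν : ∃ ν : K, p x = ν • p y := by
    by_cases hx : p x 1 = 0 <;> by_cases hy : p y 1 = 0
    · have hy0 : p y 0 ≠ 0 := fun h => hp y (by funext i; fin_cases i; exacts [h, hy])
      refine ⟨p x 0 / p y 0, ?_⟩
      funext i
      fin_cases i
      · simp [hy0]
      · simp [hx, hy]
    · simp [cls, hx, hy] at hcls
    · simp [cls, hx, hy] at hcls
    · simp only [cls, hx, hy, if_false, Option.some.injEq] at hcls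
      refine ⟨p x 1 / p y 1, ?_⟩
      funext i
      fin_cases i
      · simp only [Fin.zero_eta, Pi.smul_apply, smul_eq_mul]
        field_simp at hcls ⊢
        linear_combination hcls
      · simp [hy]
  obtain ⟨ν, hν⟩ := hν
  let κ := c x * ν ^ m * (c y)⁻¹
  have h1 : Q x = κ • Q y := by
    apply Subtype.ext
    rw [Submodule.coe_smul, ← hc, ← hc, smul_smul]
    funext i
    simp only [Pi.smul_apply, smul_eq_mul, κ]
    rw [hν, eval_smul_of_isHomogeneous (hf i)]
    field_simp [hc0 y]
  have h2 := hw (1 - κ) (x - κ * y) (by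
    simp only [Q, smul_add, smul_smul] at h1
    rw [sub_smul, sub_smul, one_smul, sub_add_sub_comm, h1, sub_self])
  have hκ : κ = 1 := (sub_eq_zero.1 h2.1).symm
  rw [hκ, one_mul] at h2
  exact hxy (sub_eq_zero.1 h2.2)

end Syzygies

/-! ### Induced syzygies of `h` and their moving planes -/

section MovingPlanes

variable {K : Type*} [Field K] {g : Fin 4 → Bin K} {n : ℕ} {b : Fin 4 → Bin K}
  {B : Fin 4 → BiRing K} {k β : ℕ} {δ : Bin K}

theorem exists_eval_ne_zero_of_ne_zero [CharZero K] {p : Bin K} (hp : p ≠ 0) :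
    ∃ q, eval q p ≠ 0 := by
  by_contra! h
  exact hp (MvPolynomial.funext fun q => by rw [h, map_zero])

theorem inducedSyzygy_zero (g b : Fin 4 → Bin K) : inducedSyzygy g b 0 =
    inTV (C (1 / 2)) * (inTV (g 0) * inSU (b 0) - inTV (g 1) * inSU (b 1)
      - inTV (g 2) * inSU (b 2) - inTV (g 3) * inSU (b 3)) := by
  simp only [inducedSyzygy, Matrix.mulVec, dotProduct, Fin.sum_univ_four, Matrix.map_apply, Nmat,
    Matrix.of_apply, Matrix.cons_val', Matrix.cons_val_zero, Matrix.cons_val_one,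
    Matrix.cons_val_fin_one, Matrix.cons_val, map_neg, map_mul]
  ring

theorem inducedSyzygy_of_ne_zero (g b : Fin 4 → Bin K) {i : Fin 4} (hi : i ≠ 0) :
    inducedSyzygy g b i = inTV (g 0) * inSU (b i) := by
  fin_cases i
  · exact absurd rfl hi
  all_goals
    simp [inducedSyzygy, Matrix.mulVec, dotProduct, Fin.sum_univ_four, Nmat]

theorem inTV_half_mul_two [CharZero K] : (inTV (C (1 / 2)) : BiRing K) * 2 = 1 := by
  have h : (2 : BiRing K) = inTV (C 2) := by rw [inTV, map_ofNat, map_ofNat]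
  rw [h, ← map_mul, ← map_mul]
  simp

/-- The `r` are the rows of the polynomial matrix `g₀² N_g⁻¹`. Consequently a common divisor of `N_g
b` divides every `g₀² bᵢ`. -/
theorem exists_sum_mul_inducedSyzygy_eq [CharZero K] (g b : Fin 4 → Bin K) (i : Fin 4) :
    ∃ r : Fin 4 → BiRing K, ∑ l, r l * inducedSyzygy g b l = inTV (g 0 ^ 2) * inSU (b i) := by
  by_cases hi : i = 0
  · subst hi
    refine ⟨![2 * inTV (g 0), inTV (g 1), inTV (g 2), inTV (g 3)], ?_⟩
    rw [Fin.sum_univ_four, inducedSyzygy_zero, inducedSyzygy_of_ne_zero g b (by decide),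
      inducedSyzygy_of_ne_zero g b (by decide), inducedSyzygy_of_ne_zero g b (by decide)]
    simp only [Matrix.cons_val_zero, Matrix.cons_val_one, Matrix.cons_val, map_pow]
    linear_combination (inTV (g 0) * (inTV (g 0) * inSU (b 0) - inTV (g 1) * inSU (b 1)
      - inTV (g 2) * inSU (b 2) - inTV (g 3) * inSU (b 3))) * inTV_half_mul_two (K := K)
  · refine ⟨fun l => if l = i then inTV (g 0) else 0, ?_⟩
    simp only [ite_mul, zero_mul, Finset.sum_ite_eq', Finset.mem_univ, if_true]
    rw [inducedSyzygy_of_ne_zero g b hi, map_pow]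
    ring

/-- This is `N_gᵀ h = g₀² f` paired with `b`. -/
theorem sum_inducedSyzygy_mul_translational [CharZero K] {f : Fin 4 → Bin K}
    (hb : ∑ i, f i * b i = 0) :
    ∑ i, inducedSyzygy g b i * translational f g i = 0 := by
  have h := congrArg inSU hb
  simp only [Fin.sum_univ_four, map_add, map_mul, map_zero] at h
  rw [Fin.sum_univ_four, inducedSyzygy_zero, inducedSyzygy_of_ne_zero g b (by decide),
    inducedSyzygy_of_ne_zero g b (by decide), inducedSyzygy_of_ne_zero g b (by decide)]
  simp only [translational]
  linear_combination (inTV (g 0) ^ 2) * h + (inSU (f 0) * inTV (g 0) *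
    (inTV (g 0) * inSU (b 0) - inTV (g 1) * inSU (b 1)
      - inTV (g 2) * inSU (b 2) - inTV (g 3) * inSU (b 3))) * inTV_half_mul_two (K := K)

theorem map_eval_inSU (q : Fin 2 → K) (p : Bin K) : map (eval q) (inSU p) = p := by
  rw [inSU, map_map]
  have : (eval q).comp C = RingHom.id K := by ext; simp
  rw [this, map_id]

theorem isHomogeneous_Nmat (hg : ∀ i, (g i).IsHomogeneous n) (i l : Fin 4) :
    (Nmat g i l).IsHomogeneous n := by
  have h0 := isHomogeneous_zero (Fin 2) K n
  fin_cases i <;> fin_cases l <;>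
    first
    | exact h0
    | exact hg 0
    | exact (hg _).C_mul _
    | exact ((hg _).C_mul _).neg

theorem coeff_inducedSyzygy (g b : Fin 4 → Bin K) (i : Fin 4) (s : Fin 2 →₀ ℕ) :
    coeff s (inducedSyzygy g b i) = ∑ l, Nmat g i l * C (coeff s (b l)) := by
  simp only [inducedSyzygy, Matrix.mulVec, dotProduct, Matrix.map_apply, coeff_sum, inTV, inSU,
    coeff_C_mul, coeff_map]

theorem isHomogeneous_inducedSyzygy (hb : ∀ i, (b i).IsHomogeneous k) (i : Fin 4) :
    (inducedSyzygy g b i).IsHomogeneous k := by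
  rw [inducedSyzygy]
  exact IsHomogeneous.sum _ _ _ fun l _ => ((hb l).map C).C_mul _

theorem isHomogeneous_coeff_inducedSyzygy (hg : ∀ i, (g i).IsHomogeneous n) (i : Fin 4)
    (s : Fin 2 →₀ ℕ) : (coeff s (inducedSyzygy g b i)).IsHomogeneous n := by
  rw [coeff_inducedSyzygy]
  refine IsHomogeneous.sum _ _ _ fun l _ => ?_
  simpa using (isHomogeneous_Nmat hg i l).mul (isHomogeneous_C (Fin 2) (coeff s (b l)))

/-- `B` is the primitive part of the syzygy induced by `b`: it is bihomogeneous of degree `(k, β)`,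
and the greatest common divisor `δ` involves only `t` and `v` and vanishes only where `g₀` does. -/
structure IsPrimitiveInduced (g b : Fin 4 → Bin K) (B : Fin 4 → BiRing K) (k β : ℕ) (δ : Bin K) :
    Prop where
  eq_mul : ∀ i, inducedSyzygy g b i = C δ * B i
  eval_ne_zero : ∀ q, eval q (g 0) ≠ 0 → eval q δ ≠ 0
  isUnit_of_dvd : ∀ e, (∀ i, e ∣ B i) → IsUnit e
  isHomogeneous : ∀ i, (B i).IsHomogeneous k
  isHomogeneous_coeff : ∀ i s, (coeff s (B i)).IsHomogeneous β

/-- At `(t, v) = q` the factor `g₀²` becomes a nonzero constant, so `e` specializes to a common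
divisor of the primitive vector `b`. This controls the gcd of `N_g b`. -/
theorem isUnit_map_eval_of_dvd [CharZero K] (hbu : ∀ e, (∀ i, e ∣ b i) → IsUnit e) {e : BiRing K}
    (he : ∀ i, e ∣ inducedSyzygy g b i) {q : Fin 2 → K} (hq : eval q (g 0) ≠ 0) :
    IsUnit (map (eval q) e) := by
  apply hbu
  intro i
  obtain ⟨r, hr⟩ := exists_sum_mul_inducedSyzygy_eq g b i
  have h1 : e ∣ inTV (g 0 ^ 2) * inSU (b i) := by
    rw [← hr]
    exact Finset.dvd_sum fun l _ => (he l).mul_left _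
  have h2 := map_dvd (map (σ := Fin 2) (eval q)) h1
  rw [map_mul, map_eval_inSU, inTV, map_C] at h2
  have h3 : IsUnit (C (eval q (g 0 ^ 2)) : Bin K) := by
    refine (isUnit_iff_ne_zero.2 ?_).map C
    rw [map_pow]
    exact pow_ne_zero _ hq
  exact h3.dvd_mul_left.1 h2

theorem IsPrimitivePart.exists_isPrimitiveInduced [CharZero K]
    (hB : IsPrimitivePart (inducedSyzygy g b) B) (hg : ∀ i, (g i).IsHomogeneous n) (hg0 : g 0 ≠ 0)
    (hb : ∀ i, (b i).IsHomogeneous k) (hbu : ∀ e, (∀ i, e ∣ b i) → IsUnit e) :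
    ∃ β δ, IsPrimitiveInduced g b B k β δ := by
  obtain ⟨d, hd, hdB⟩ := hB
  have hdB' : ∀ i, inducedSyzygy g b i = d * B i := fun i => by rw [hdB]; rfl
  have hne : ∃ i, inducedSyzygy g b i ≠ 0 := by
    by_contra! h
    refine not_isUnit_zero (hbu 0 fun i => ?_)
    obtain ⟨r, hr⟩ := exists_sum_mul_inducedSyzygy_eq g b i
    simp only [h, mul_zero, Finset.sum_const_zero] at hr
    have h1 := (mul_eq_zero.1 hr.symm).resolve_left (by simpa [inTV] using hg0)
    rw [← map_eval_inSU 0 (b i), h1, map_zero]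
  obtain ⟨i₀, hi₀⟩ := hne
  obtain ⟨q₀, hq₀⟩ := exists_eval_ne_zero_of_ne_zero hg0
  have hu := fun q hq => isUnit_map_eval_of_dvd (q := q) hbu hd.1 hq
  -- The gcd is a form in `s, u`; its specialization at `q₀` is a unit, so its degree is `0`.
  have hdeg : ∃ δ, d = C δ := by
    obtain ⟨e, he⟩ := exists_isHomogeneous_of_dvd (hd.1 i₀) (isHomogeneous_inducedSyzygy hb i₀) hi₀
    by_cases he0 : e = 0
    · subst he0
      exact ⟨_, eq_C_of_isHomogeneous_zero he⟩
    · exact absurd (hu q₀ hq₀) (not_isUnit_of_isHomogeneous (he.map _) he0)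
  obtain ⟨δ, rfl⟩ := hdeg
  have hδ0 : δ ≠ 0 := by
    rintro rfl
    apply hi₀
    rw [hdB', map_zero, zero_mul]
  have hcoeff : ∀ i s, δ * coeff s (B i) = coeff s (inducedSyzygy g b i) := fun i s => by
    rw [hdB', coeff_C_mul]
  have hδh : ∃ γ, δ.IsHomogeneous γ := by
    obtain ⟨s, hs⟩ := ne_zero_iff.1 hi₀
    exact exists_isHomogeneous_of_dvd ⟨_, (hcoeff i₀ s).symm⟩
      (isHomogeneous_coeff_inducedSyzygy hg i₀ s) hs
  obtain ⟨γ, hγ⟩ := hδh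
  -- Any nonzero coefficient of `B` has degree `e'` with `γ + e' = n`, so the subtraction is exact
  -- where it matters.
  refine ⟨n - γ, δ, hdB', ?_, ?_, ?_, ?_⟩
  · intro q hq
    have := hu q hq
    rw [map_C] at this
    intro h0
    rw [h0, map_zero] at this
    exact not_isUnit_zero this
  · intro e he
    have h1 : C δ * e ∣ C δ := hd.2 _ fun i => by
      rw [hdB' i]
      exact mul_dvd_mul_left _ (he i)
    obtain ⟨r, hr⟩ := h1
    refine IsUnit.of_mul_eq_one r (mul_left_cancel₀ (by simpa using hδ0 : (C δ : BiRing K) ≠ 0) ?_)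
    rw [mul_one, ← mul_assoc]
    exact hr.symm
  · intro i s hs
    by_contra hdeg
    apply hs
    have h1 := hcoeff i s
    rw [(isHomogeneous_inducedSyzygy hb i).coeff_eq_zero (fun h => hdeg (by
      rw [← h, Finsupp.degree_eq_weight_one]; rfl))] at h1
    exact (mul_eq_zero.1 h1).resolve_left hδ0
  · intro i s
    by_cases h0 : coeff s (B i) = 0
    · rw [h0]
      exact isHomogeneous_zero _ _ _
    · have h1 := isHomogeneous_coeff_inducedSyzygy (b := b) hg i s
      rw [← hcoeff] at h1
      obtain ⟨e, e', he, he', hee⟩ := isHomogeneous_of_mul h1 (mul_ne_zero hδ0 h0)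
      have := he.inj_right hγ hδ0
      rwa [show n - γ = e' by omega]

theorem coeff_movingPlane (B : Fin 4 → BiRing K) (s : Fin 2 →₀ ℕ) :
    coeff s (movingPlane B) = ∑ i, map C (coeff s (B i)) * C (X i) := by
  simp only [movingPlane, coeff_sum, mul_comm _ (C (C _)), coeff_C_mul, toFull, coeff_map,
    mul_comm _ (C (X _))]

theorem isHomogeneous_movingPlane (hB : ∀ i, (B i).IsHomogeneous k) :
    (movingPlane B).IsHomogeneous k := by
  refine IsHomogeneous.sum _ _ _ fun i _ => ?_
  exact ((hB i).map (map C)).mul (isHomogeneous_C (Fin 2) (C (X i) : TVCoord K))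

theorem scalesBy_gscale_coeff_movingPlane (hB : ∀ i s, (coeff s (B i)).IsHomogeneous β)
    (s : Fin 2 →₀ ℕ) :
    ScalesBy (gscale (Fin 2) (Coord K)) β (coeff s (movingPlane B)) := by
  rw [scalesBy_gscale_iff, coeff_movingPlane]
  refine IsHomogeneous.sum _ _ _ fun i _ => ?_
  simpa using ((hB i s).map C).mul (isHomogeneous_C (Fin 2) (X i : Coord K))

theorem scalesBy_gscaleInner_coeff_movingPlane (B : Fin 4 → BiRing K) (s : Fin 2 →₀ ℕ) :
    ScalesBy (gscaleInner (Fin 2) (Fin 4) K) 1 (coeff s (movingPlane B)) := by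
  rw [scalesBy_gscaleInner_iff, coeff_movingPlane]
  intro r
  rw [coeff_sum]
  refine IsHomogeneous.sum _ _ _ fun i _ => ?_
  rw [mul_comm, coeff_C_mul, coeff_map, mul_comm]
  exact isHomogeneous_C_mul_X _ _

theorem map_eval_movingPlane (B : Fin 4 → BiRing K) (P : Fin 4 → K) :
    map (map (eval P)) (movingPlane B) = ∑ i, B i * C (C (P i)) := by
  simp only [movingPlane, map_sum, map_mul, map_C, eval_X, toFull, map_map]
  have h : (eval P).comp C = RingHom.id K := by ext; simp
  have h' : (map (σ := Fin 2) (eval P)).comp (map (σ := Fin 2) (C : K →+* Coord K)) =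
      RingHom.id (Bin K) := by
    refine ringHom_ext (fun x => ?_) fun x => ?_
    · simp
    · simp
  simp only [h', map_id]

theorem eval₂_substParam_movingPlane (h : Fin 4 → BiRing K) (B : Fin 4 → BiRing K) :
    eval₂ (substParam h) X (movingPlane B) = ∑ i, B i * h i := by
  have h' : (substParam h).comp (map (σ := Fin 2) (C : K →+* Coord K)) = C := by
    refine ringHom_ext (fun x => ?_) fun x => ?_
    · simp [substParam, inTV]
    · simp [substParam, inTV]
  simp only [movingPlane, eval₂_sum, eval₂_mul, toFull, eval₂_map, eval₂_C, h', eval₂_eta]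
  simp [substParam]

theorem IsPrimitiveInduced.delta_ne_zero [CharZero K] (hB : IsPrimitiveInduced g b B k β δ) (hg0 : g 0 ≠ 0) :
    δ ≠ 0 := by
  rintro rfl
  obtain ⟨q₀, hq₀⟩ := exists_eval_ne_zero_of_ne_zero hg0
  exact hB.eval_ne_zero q₀ hq₀ (map_zero _)

theorem IsPrimitiveInduced.sum_mul_eq_zero [CharZero K] (hB : IsPrimitiveInduced g b B k β δ)
    (hg0 : g 0 ≠ 0) {f : Fin 4 → Bin K} (hb : ∑ i, f i * b i = 0) :
    ∑ i, B i * translational f g i = 0 := by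
  have h := sum_inducedSyzygy_mul_translational (g := g) hb
  simp only [hB.eq_mul, mul_assoc, ← Finset.mul_sum] at h
  exact (mul_eq_zero.1 h).resolve_left (by simpa using hB.delta_ne_zero hg0)

theorem IsPrimitiveInduced.movingPlane_ne_zero (hB : IsPrimitiveInduced g b B k β δ) :
    movingPlane B ≠ 0 := by
  intro h
  refine not_isUnit_zero (hB.isUnit_of_dvd 0 fun i => ?_)
  have h1 := map_eval_movingPlane B (Pi.single i 1)
  rw [h, map_zero] at h1
  simp [Pi.single_apply] at h1
  rw [← h1]

end MovingPlanes

/-! ### The prime moving plane `xA` and the resultants in `s, u` and `t, v` -/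

section Resultants

variable {K : Type*} [Field K] {f g : Fin 4 → Bin K} {m n : ℕ}

/-- The moving plane `a₀ w + a₁ x + a₂ y + a₃ z` with coefficients in `K[t,v]`. -/
def tvPlane (a : Fin 4 → Bin K) : TVCoord K :=
  ∑ i, map C (a i) * C (X i)

theorem movingPlane_C (a : Fin 4 → Bin K) : movingPlane (fun i => C (a i)) = C (tvPlane a) := by
  simp only [movingPlane, tvPlane, toFull, map_C, map_sum, map_mul]

theorem map_eval_tvPlane (a : Fin 4 → Bin K) (P : Fin 4 → K) :
    map (eval P) (tvPlane a) = ∑ i, a i * C (P i) := by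
  have h : (eval P).comp C = RingHom.id K := by ext; simp
  simp only [tvPlane, map_sum, map_mul, map_map, h, map_id, map_C, eval_X]

theorem isHomogeneous_tvPlane {a : Fin 4 → Bin K} {α : ℕ} (ha : ∀ i, (a i).IsHomogeneous α) :
    (tvPlane a).IsHomogeneous α :=
  IsHomogeneous.sum _ _ _ fun i _ => by
    simpa using ((ha i).map C).mul (isHomogeneous_C (Fin 2) (X i : Coord K))

theorem isHomogeneous_coeff_tvPlane (a : Fin 4 → Bin K) (s : Fin 2 →₀ ℕ) :
    (coeff s (tvPlane a)).IsHomogeneous 1 := by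
  rw [tvPlane, coeff_sum]
  refine IsHomogeneous.sum _ _ _ fun i _ => ?_
  rw [mul_comm, coeff_C_mul, coeff_map, mul_comm]
  exact isHomogeneous_C_mul_X _ _

theorem dvd_of_map_C_dvd_tvPlane {a : Fin 4 → Bin K} {e : Bin K} (he : map C e ∣ tvPlane a)
    (i : Fin 4) : e ∣ a i := by
  have h := map_dvd (map (σ := Fin 2) (eval (Pi.single i (1 : K)))) he
  have h' : (eval (Pi.single i (1 : K))).comp C = RingHom.id K := by ext; simp
  rw [map_eval_tvPlane, map_map, h', map_id] at h
  simpa [Pi.single_apply] using h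

theorem tvPlane_ne_zero {a : Fin 4 → Bin K} (ha : ∀ e, (∀ i, e ∣ a i) → IsUnit e) :
    tvPlane a ≠ 0 := fun h =>
  not_isUnit_zero (ha 0 fun i => dvd_of_map_C_dvd_tvPlane (by rw [h]; exact dvd_zero _) i)

/-- In a factorization of a polynomial of degree 1 in `w, x, y, z`, one factor has degree 0. It lies
in `K[t,v]` and divides every `aᵢ`, hence is a unit by primitivity. -/
theorem prime_tvPlane {a : Fin 4 → Bin K} (ha : ∀ e, (∀ i, e ∣ a i) → IsUnit e) :
    Prime (tvPlane a) := by
  have hunit : ∀ y : TVCoord K, y ∣ tvPlane a → (∀ s, (coeff s y).IsHomogeneous 0) →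
      IsUnit y := by
    intro y hy hy0
    have h1 : y = map C (map constantCoeff y) := by
      ext1 s
      rw [coeff_map, coeff_map]
      exact eq_C_of_isHomogeneous_zero (hy0 s)
    rw [h1] at hy ⊢
    exact (ha _ (dvd_of_map_C_dvd_tvPlane hy)).map (map C)
  rw [← irreducible_iff_prime, irreducible_iff]
  constructor
  · intro hu
    have h1 : ScalesBy (gscaleInner (Fin 2) (Fin 4) K) 1 (tvPlane a) :=
      scalesBy_gscaleInner_iff.2 (isHomogeneous_coeff_tvPlane a)
    obtain ⟨y, hy⟩ := hu.exists_right_inv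
    have h3 : ScalesBy (gscaleInner (Fin 2) (Fin 4) K) 0 (tvPlane a * y) := by
      rw [hy, ScalesBy, map_one, map_one, pow_zero, mul_one]
    obtain ⟨e, e', he, -, hee⟩ := ScalesBy.of_mul eval_one_gscaleInner h3 (by rw [hy]; simp)
    rw [scalesBy_gscaleInner_iff] at h1 he
    obtain ⟨s, hs⟩ := ne_zero_iff.1 (tvPlane_ne_zero ha)
    have := (h1 s).inj_right (he s) hs
    omega
  · intro y z hyz
    have h1 : ScalesBy (gscaleInner (Fin 2) (Fin 4) K) 1 (y * z) := by
      rw [← hyz]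
      exact scalesBy_gscaleInner_iff.2 (isHomogeneous_coeff_tvPlane a)
    obtain ⟨e, e', he, he', hee⟩ := ScalesBy.of_mul eval_one_gscaleInner h1
      (hyz ▸ tvPlane_ne_zero ha)
    rw [scalesBy_gscaleInner_iff] at he he'
    rcases (by omega : e = 0 ∨ e' = 0) with rfl | rfl
    · exact Or.inl (hunit y ⟨z, hyz⟩ he)
    · exact Or.inr (hunit z ⟨y, by rw [hyz, mul_comm]⟩ he')

/-- `N_g(q)ᵀ` is triangular with nonzero diagonal, so points in the space of `f` lift to the space
of `h`. -/
theorem exists_transpose_Nmat_solution [CharZero K] {q : Fin 2 → K} (hq : eval q (g 0) ≠ 0)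
    (P' : Fin 4 → K) : ∃ P : Fin 4 → K, ∀ l, ∑ i, eval q (Nmat g i l) * P i = P' l := by
  let P0 := 2 * P' 0 / eval q (g 0)
  refine ⟨![P0, (P' 1 + eval q (g 1) * P0 / 2) / eval q (g 0),
    (P' 2 + eval q (g 2) * P0 / 2) / eval q (g 0),
    (P' 3 + eval q (g 3) * P0 / 2) / eval q (g 0)], fun l => ?_⟩
  fin_cases l <;> simp [Fin.sum_univ_four, Nmat, P0] <;> field_simp <;> ring

/-- Adjointness `(N_g b) · P = b · (N_gᵀ P)`: up to the factor `δ(q)`, the moving plane of `B` at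
`P` is that of `b` at `P'`. -/
theorem eval_mul_sum_eval {b : Fin 4 → Bin K} {B : Fin 4 → BiRing K} {δ : Bin K}
    (hB : ∀ i, inducedSyzygy g b i = C δ * B i) {p q : Fin 2 → K} {P P' : Fin 4 → K}
    (hP : ∀ l, ∑ i, eval q (Nmat g i l) * P i = P' l) :
    eval q δ * ∑ i, eval p (map (eval q) (B i)) * P i = ∑ l, eval p (b l) * P' l := by
  have h1 : ∀ i, eval q δ * eval p (map (eval q) (B i)) =
      ∑ l, eval q (Nmat g i l) * eval p (b l) := by
    intro i
    have h2 := congrArg (fun r => eval p (map (eval q) r)) (hB i)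
    simp only [map_mul, map_C, eval_C] at h2
    rw [← h2, inducedSyzygy]
    simp only [Matrix.mulVec, dotProduct, Matrix.map_apply, map_sum, map_mul, inTV, map_C, eval_C]
    refine Finset.sum_congr rfl fun l _ => ?_
    rw [map_eval_inSU]
  simp only [Finset.mul_sum, ← mul_assoc, h1, ← hP, Finset.sum_mul]
  rw [Finset.sum_comm]
  refine Finset.sum_congr rfl fun l _ => Finset.sum_congr rfl fun i _ => ?_
  ring

theorem eval_map_movingPlane (B : Fin 4 → BiRing K) (p q : Fin 2 → K) (P : Fin 4 → K) :
    eval p (map ((eval q).comp (map (eval P))) (movingPlane B)) =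
      ∑ i, eval p (map (eval q) (B i)) * P i := by
  rw [← map_map, map_eval_movingPlane]
  simp

variable {μ : Fin 3 → ℕ} {φ : Matrix (Fin 4) (Fin 3) (Bin K)} {a : Fin 4 → Bin K}
  {B B' : Fin 4 → BiRing K} {α β β' : ℕ} {δ δ₁ δ₂ : Bin K}

theorem not_tvPlane_dvd_resultant [IsAlgClosed K] [CharZero K]
    (hf : ∀ i, (f i).IsHomogeneous m) (hgcd : IsGCDOf 1 f) (hf0 : f 0 ≠ 0) (hg0 : g 0 ≠ 0)
    (hφ : IsSyzygyMatrix f μ φ) (h0 : μ 0 = 0) (h1 : μ 1 ≠ 0)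
    (hA : IsPrimitiveInduced g (fun i => φ i 0) (fun i => C (a i)) 0 α δ)
    (hB : IsPrimitiveInduced g (fun i => φ i 1) B (μ 1) β δ₁)
    (hB' : IsPrimitiveInduced g (fun i => φ i 2) B' (μ 2) β' δ₂) :
    ¬ tvPlane a ∣ Polynomial.resultant (dehomogenize (movingPlane B))
      (dehomogenize (movingPlane B')) (μ 1) (μ 2) := by
  rintro ⟨Q, hQ⟩
  have h2 : μ 2 ≠ 0 := by
    have := hφ.monotone (show (1 : Fin 3) ≤ 2 by decide)
    omega
  obtain ⟨q, hq⟩ := exists_eval_ne_zero_of_ne_zero hg0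
  have hconst : ∀ i, φ i 0 = C (constantCoeff (φ i 0)) := fun i =>
    eq_C_of_isHomogeneous_zero (h0 ▸ hφ.isHomogeneous i 0)
  -- `P'` lies in the plane of the constant syzygy but off the cone over the curve. If `xA` divided
  -- the resultant, `xB` and `xC` would have a common root `p` at the lift `P`; then `P'` would be
  -- orthogonal to all syzygies at `p`, that is, a multiple of `f(p)`.
  obtain ⟨P', hP'0, hP'⟩ := exists_orthogonal_forall_smul_ne hf hf0
    fun i => constantCoeff (φ i 0)
  obtain ⟨P, hP⟩ := exists_transpose_Nmat_solution hq P'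
  let ψ : TVCoord K →+* K := (eval q).comp (map (eval P))
  have hcol0 : ∀ p, ∑ i, eval p (φ i 0) * P' i = 0 := by
    intro p
    rw [← hP'0]
    refine Finset.sum_congr rfl fun i _ => ?_
    rw [hconst i]
    simp
  have hψA : ψ (tvPlane a) = 0 := by
    have h3 := eval_mul_sum_eval hA.eq_mul (p := 0) hP
    rw [hcol0] at h3
    have h4 := (mul_eq_zero.1 h3).resolve_left (hA.eval_ne_zero q hq)
    rw [← h4]
    simp [ψ, map_eval_tvPlane]
  have hres := congrArg ψ hQ
  rw [map_mul, hψA, zero_mul, ← Polynomial.resultant_map_map, ← dehomogenize_map,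
    ← dehomogenize_map] at hres
  obtain ⟨p, hp, hp1, hp2⟩ := exists_common_zero_of_resultant_eq_zero
    ((isHomogeneous_movingPlane hB.isHomogeneous).map ψ)
    ((isHomogeneous_movingPlane hB'.isHomogeneous).map ψ) h1 h2 hres
  rw [eval_map_movingPlane] at hp1 hp2
  have hcol1 := eval_mul_sum_eval hB.eq_mul (p := p) hP
  have hcol2 := eval_mul_sum_eval hB'.eq_mul (p := p) hP
  rw [hp1, mul_zero] at hcol1
  rw [hp2, mul_zero] at hcol2
  obtain ⟨c, hc⟩ := hφ.exists_smul_eq hf hgcd hp (P := P') (by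
    intro j
    fin_cases j
    · exact hcol0 p
    · exact hcol1.symm
    · exact hcol2.symm)
  exact hP' p hp c hc

/-- The common zero is the generic point: the variables `s, u` themselves. -/
theorem substParam_resultant_eq_zero (h : Fin 4 → BiRing K) {k k' : ℕ}
    (hB : ∀ i, (B i).IsHomogeneous k) (hB' : ∀ i, (B' i).IsHomogeneous k') (hk : k ≠ 0)
    (hBh : ∑ i, B i * h i = 0) (hBh' : ∑ i, B' i * h i = 0) :
    substParam h (Polynomial.resultant (dehomogenize (movingPlane B))
      (dehomogenize (movingPlane B')) k k') = 0 :=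
  map_resultant_eq_zero_of_common_zero (substParam h) (isHomogeneous_movingPlane hB)
    (isHomogeneous_movingPlane hB') (Or.inl hk) X (X_ne_zero 1)
    (by rw [eval₂_substParam_movingPlane, hBh]) (by rw [eval₂_substParam_movingPlane, hBh'])

theorem exists_irreducible_dvd_map_eq_zero {S S' : Type*} [CommRing S] [IsDomain S]
    [UniqueFactorizationMonoid S] [CommRing S'] [IsDomain S'] (θ : S →+* S') {x : S} (hx : x ≠ 0)
    (hθ : θ x = 0) : ∃ p, Irreducible p ∧ p ∣ x ∧ θ p = 0 := by
  obtain ⟨F, hF, hFx⟩ := UniqueFactorizationMonoid.exists_prime_factors x hx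
  have h1 : θ F.prod = 0 := by
    obtain ⟨u, hu⟩ := hFx
    have h2 : θ F.prod * θ u = 0 := by rw [← map_mul, hu, hθ]
    exact (mul_eq_zero.1 h2).resolve_right ((u.isUnit.map θ).ne_zero)
  rw [map_multiset_prod, Multiset.prod_eq_zero_iff, Multiset.mem_map] at h1
  obtain ⟨p, hp, hp0⟩ := h1
  exact ⟨p, (hF p hp).irreducible, (Multiset.dvd_prod hp).trans hFx.dvd, hp0⟩

/-- The homomorphism `K[w,x,y,z] → R` substituting the parameterization `h`. -/
def paramHom (h : Fin 4 → BiRing K) : Coord K →+* BiRing K :=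
  eval₂Hom (inTV.comp C) h

theorem substParam_apply (h : Fin 4 → BiRing K) (L : TVCoord K) :
    substParam h L = eval₂ (paramHom h) (fun j => inTV (X j)) L := rfl

theorem substParam_C (h : Fin 4 → BiRing K) (G : Coord K) :
    substParam h (C G) = paramHom h G := by
  rw [substParam_apply, eval₂_C]

theorem substParam_tvPlane (h : Fin 4 → BiRing K) (a : Fin 4 → Bin K) :
    substParam h (tvPlane a) = ∑ i, C (a i) * h i := by
  have h1 := eval₂_substParam_movingPlane h fun i => C (a i)
  rwa [movingPlane_C, eval₂_C] at h1

theorem paramHom_resultant_eq_zero (h : Fin 4 → BiRing K) {L L' : TVCoord K} {d e : ℕ}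
    (hL : L.IsHomogeneous d) (hL' : L'.IsHomogeneous e) (hde : d ≠ 0 ∨ e ≠ 0)
    (h0 : substParam h L = 0) (h0' : substParam h L' = 0) :
    paramHom h (Polynomial.resultant (dehomogenize L) (dehomogenize L') d e) = 0 :=
  map_resultant_eq_zero_of_common_zero (paramHom h) hL hL' hde (fun j => inTV (X j))
    (by simp [inTV]) h0 h0'

end Resultants

/-! ### Algebraic independence of three components of `h` -/

section Independence

variable {K : Type*} [Field K]

/-- Choose `c` so that `r = q - c p` has no term in degree `deg p`. If `r ≠ 0`, the leading term of
`p X r' - r X p'` carries the factor `deg r - deg p`, nonzero in characteristic zero. -/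
theorem exists_eq_C_mul_of_wronskian_eq_zero [CharZero K] {p q : Polynomial K} (hp : p ≠ 0)
    (h : p * q.derivative - q * p.derivative = 0) : ∃ c, q = Polynomial.C c * p := by
  let c := q.coeff p.natDegree / p.leadingCoeff
  let r := q - Polynomial.C c * p
  have hlc : p.leadingCoeff ≠ 0 := Polynomial.leadingCoeff_ne_zero.2 hp
  have hr : p * (Polynomial.X * r.derivative) - r * (Polynomial.X * p.derivative) = 0 := by
    simp only [r, Polynomial.derivative_sub, Polynomial.derivative_C_mul]
    linear_combination Polynomial.X * h
  have hrN : r.coeff p.natDegree = 0 := by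
    simp only [r, Polynomial.coeff_sub, Polynomial.coeff_C_mul, c, Polynomial.coeff_natDegree]
    field_simp
    ring
  have hX : ∀ (s : Polynomial K) (k : ℕ), (Polynomial.X * s.derivative).coeff k = s.coeff k * k := by
    intro s k
    cases k with
    | zero => simp
    | succ k => rw [Polynomial.coeff_X_mul, Polynomial.coeff_derivative]; push_cast; ring
  have hXd : ∀ s : Polynomial K, (Polynomial.X * s.derivative).natDegree ≤ s.natDegree := by
    intro s
    rw [Polynomial.natDegree_le_iff_coeff_eq_zero]
    intro k hk
    rw [hX, Polynomial.coeff_eq_zero_of_natDegree_lt hk, zero_mul]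
  have hr0 : r = 0 := by
    by_contra hr0
    have hlr : r.leadingCoeff ≠ 0 := Polynomial.leadingCoeff_ne_zero.2 hr0
    have hne : r.natDegree ≠ p.natDegree := by
      intro h
      rw [← h, Polynomial.coeff_natDegree] at hrN
      exact hlr hrN
    have h1 := congrArg (fun s => Polynomial.coeff s (p.natDegree + r.natDegree)) hr
    simp only [Polynomial.coeff_sub, Polynomial.coeff_zero] at h1
    rw [Polynomial.coeff_mul_add_eq_of_natDegree_le le_rfl (hXd r), add_comm p.natDegree,
      Polynomial.coeff_mul_add_eq_of_natDegree_le le_rfl (hXd p), hX, hX,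
      Polynomial.coeff_natDegree, Polynomial.coeff_natDegree] at h1
    have h2 : p.leadingCoeff * r.leadingCoeff * ((r.natDegree : K) - p.natDegree) = 0 := by
      linear_combination h1
    have h3 := (mul_eq_zero.1 h2).resolve_left (mul_ne_zero hlc hlr)
    exact hne (by exact_mod_cast sub_eq_zero.1 h3)
  exact ⟨c, sub_eq_zero.1 hr0⟩

theorem exists_eq_C_mul_of_wronskian_dehomogenize_eq_zero [CharZero K] {p q : Bin K} {d : ℕ}
    (hp : p.IsHomogeneous d) (hq : q.IsHomogeneous d) (hp0 : p ≠ 0)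
    (h : dehomogenize p * (dehomogenize q).derivative -
      dehomogenize q * (dehomogenize p).derivative = 0) : ∃ c, q = C c * p := by
  obtain ⟨c, hc⟩ := exists_eq_C_mul_of_wronskian_eq_zero (dehomogenize_ne_zero hp hp0) h
  refine ⟨c, ?_⟩
  rw [← homogenize_dehomogenize hq, hc, Polynomial.homogenize_C_mul, homogenize_dehomogenize hp]

theorem derivation_aeval {R' σ : Type*} [CommRing R'] [Algebra K R'] [Fintype σ]
    (D : Derivation K R' R') (h : σ → R') (G : MvPolynomial σ K) :
    D (aeval h G) = ∑ k, aeval h (pderiv k G) * D (h k) := by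
  classical
  induction G using MvPolynomial.induction_on with
  | C a => simp
  | add p q hp hq => simp [hp, hq, add_mul, Finset.sum_add_distrib]
  | mul_X p i hp =>
    have h1 : ∀ k, aeval h (pderiv k (p * X i)) * D (h k) =
        h i * (aeval h (pderiv k p) * D (h k)) + (if k = i then aeval h p * D (h i) else 0) := by
      intro k
      rw [pderiv_mul, map_add, map_mul, map_mul, aeval_X, pderiv_X]
      by_cases hk : k = i
      · subst hk
        simp
        ring
      · simp [hk, Ne.symm hk]
        ring
    simp only [h1, Finset.sum_add_distrib, ← Finset.mul_sum, ← hp]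
    simp [mul_comm]

/-- Criterion for the algebraic independence of `P₀ Q k + P k Q₀`, where the `P k` are constants
for the derivation `∂'` and the `Q k` are constants for the derivation `∂`. -/
theorem eq_zero_of_aeval_translational_eq_zero {R' : Type*} [CommRing R'] [IsDomain R']
    [Algebra K R'] [CharZero K] (D D' : Derivation K R' R') (P Q : Fin 3 → R')
    (hP : ∀ k, D' (P k) = 0) (hQ : ∀ k, D (Q k) = 0) (hP0 : P 0 ≠ 0) (hQ0 : Q 0 ≠ 0)
    (hdet : (P 0 * D (P 1) - P 1 * D (P 0)) * (Q 0 * D' (Q 2) - Q 2 * D' (Q 0)) -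
      (P 0 * D (P 2) - P 2 * D (P 0)) * (Q 0 * D' (Q 1) - Q 1 * D' (Q 0)) ≠ 0) (d : ℕ) :
    ∀ G : MvPolynomial (Fin 3) K, G.IsHomogeneous d →
      aeval (fun k => P 0 * Q k + P k * Q 0) G = 0 → G = 0 := by
  induction d with
  | zero =>
    intro G hG h
    rw [eq_C_of_isHomogeneous_zero hG] at h ⊢
    rw [aeval_C, map_eq_zero_iff _ (FaithfulSMul.algebraMap_injective K R')] at h
    rw [h, map_zero]
  | succ d ih =>
    intro G hG h
    -- Euler's formula and the chain rule for `D` and `D'` give three linear equations for the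
    -- values `a k` of the partial derivatives of `G`. Eliminating `a 0` leaves a system with
    -- determinant `hdet`; so all `a k` vanish, the partials are `0` by induction, and Euler gives
    -- `G = 0`.
    have hE0 := congrArg (aeval fun k => P 0 * Q k + P k * Q 0) hG.sum_X_mul_pderiv
    have hE1 := derivation_aeval D (fun k => P 0 * Q k + P k * Q 0) G
    have hE2 := derivation_aeval D' (fun k => P 0 * Q k + P k * Q 0) G
    rw [h, map_zero] at hE1 hE2
    rw [map_nsmul, h, smul_zero] at hE0
    simp only [map_mul, aeval_X, Fin.sum_univ_three, map_add, Derivation.leibniz, hP, hQ,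
      smul_eq_mul, mul_zero, add_zero, zero_add] at hE0 hE1 hE2
    set a := fun k => aeval (fun k => P 0 * Q k + P k * Q 0) (pderiv k G) with ha
    change (P 0 * Q 0 + P 0 * Q 0) * a 0 + (P 0 * Q 1 + P 1 * Q 0) * a 1 +
      (P 0 * Q 2 + P 2 * Q 0) * a 2 = 0 at hE0
    change 0 = a 0 * (Q 0 * D (P 0) + Q 0 * D (P 0)) + a 1 * (Q 1 * D (P 0) + Q 0 * D (P 1)) +
      a 2 * (Q 2 * D (P 0) + Q 0 * D (P 2)) at hE1
    change 0 = a 0 * (P 0 * D' (Q 0) + P 0 * D' (Q 0)) + a 1 * (P 0 * D' (Q 1) + P 1 * D' (Q 0)) +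
      a 2 * (P 0 * D' (Q 2) + P 2 * D' (Q 0)) at hE2
    have hF1 : Q 0 * (a 1 * (P 0 * D (P 1) - P 1 * D (P 0)) +
        a 2 * (P 0 * D (P 2) - P 2 * D (P 0))) = 0 := by
      linear_combination - P 0 * hE1 - D (P 0) * hE0
    have hF2 : P 0 * (a 1 * (Q 0 * D' (Q 1) - Q 1 * D' (Q 0)) +
        a 2 * (Q 0 * D' (Q 2) - Q 2 * D' (Q 0))) = 0 := by
      linear_combination - Q 0 * hE2 - D' (Q 0) * hE0
    have hG1 := (mul_eq_zero.1 hF1).resolve_left hQ0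
    have hG2 := (mul_eq_zero.1 hF2).resolve_left hP0
    have ha1 : a 1 = 0 := by
      refine (mul_eq_zero.1 ?_).resolve_right hdet
      linear_combination (Q 0 * D' (Q 2) - Q 2 * D' (Q 0)) * hG1 -
        (P 0 * D (P 2) - P 2 * D (P 0)) * hG2
    have ha2 : a 2 = 0 := by
      refine (mul_eq_zero.1 ?_).resolve_right hdet
      linear_combination (P 0 * D (P 1) - P 1 * D (P 0)) * hG2 -
        (Q 0 * D' (Q 1) - Q 1 * D' (Q 0)) * hG1
    have ha0 : a 0 = 0 := by
      rw [ha1, ha2, mul_zero, mul_zero, add_zero, add_zero, ← two_mul] at hE0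
      have h2 : (2 : R') ≠ 0 := by
        have := (map_ne_zero_iff _ (FaithfulSMul.algebraMap_injective K R')).2
          (two_ne_zero : (2 : K) ≠ 0)
        rwa [map_ofNat] at this
      exact (mul_eq_zero.1 hE0).resolve_left (mul_ne_zero h2 (mul_ne_zero hP0 hQ0))
    have hpd : ∀ k, pderiv k G = 0 := by
      intro k
      apply ih _ (hG.pderiv (i := k))
      fin_cases k
      · exact ha0
      · exact ha1
      · exact ha2
    have hE := hG.sum_X_mul_pderiv
    simp only [hpd, mul_zero, Finset.sum_const_zero] at hE
    have := (smul_eq_zero.1 hE.symm).resolve_left (by omega)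
    exact this

variable {f g : Fin 4 → Bin K} {m n : ℕ}

/-- The Wronskian of `f₀` and `f i`, after dehomogenization. -/
def dehomWronskian (f : Fin 4 → Bin K) (i : Fin 4) : Polynomial K :=
  dehomogenize (f 0) * (dehomogenize (f i)).derivative -
    dehomogenize (f i) * (dehomogenize (f 0)).derivative

/-- Otherwise every `g i` is a constant multiple of `g 0`, which then divides the gcd `1` although
it has positive degree. -/
theorem exists_dehomWronskian_ne_zero [CharZero K] (hn : n ≠ 0) (hg : ∀ i, (g i).IsHomogeneous n)
    (hgcd : IsGCDOf 1 g) (hg0 : g 0 ≠ 0) : ∃ j, dehomWronskian g j ≠ 0 := by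
  by_contra! h
  refine not_isUnit_of_isHomogeneous (hg 0) hn (isUnit_of_dvd_one (hgcd.2 _ fun i => ?_))
  obtain ⟨c, hc⟩ := exists_eq_C_mul_of_wronskian_dehomogenize_eq_zero (hg 0) (hg i) hg0 (h i)
  rw [hc]
  exact dvd_mul_left _ _

/-- The homomorphism `K[s,u,t,v] → K[s,t]` with `u, v ↦ 1`. -/
def affineHom (K : Type*) [Field K] : BiRing K →+* MvPolynomial (Fin 2) K :=
  eval₂Hom (eval₂Hom C ![X 1, 1]) ![X 0, 1]

theorem affineHom_inSU (p : Bin K) : affineHom K (inSU p) = Polynomial.aeval (X 0) (dehomogenize p) := by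
  induction p using MvPolynomial.induction_on with
  | C a => simp [affineHom, inSU, dehomogenize]
  | add p q hp hq => simp only [map_add, hp, hq, dehomogenize]
  | mul_X p i hp =>
    rw [map_mul, map_mul, hp, dehomogenize, dehomogenize, map_mul, map_mul]
    congr 1
    fin_cases i <;> simp [affineHom, inSU]

theorem affineHom_inTV (p : Bin K) : affineHom K (inTV p) = Polynomial.aeval (X 1) (dehomogenize p) := by
  induction p using MvPolynomial.induction_on with
  | C a => simp [affineHom, inTV, dehomogenize]
  | add p q hp hq => simp only [map_add, hp, hq, dehomogenize]
  | mul_X p i hp =>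
    rw [map_mul, map_mul, hp, dehomogenize, dehomogenize, map_mul, map_mul]
    congr 1
    fin_cases i <;> simp [affineHom, inTV]

/-- Fix `j` with nonzero Wronskian for `g` and specialize `t` where it does not vanish. If all
determinants were zero, each Wronskian of `f` would be a constant multiple of the `j`-th, so every
`f i` would lie in the span of `f j` and `f 0`. -/
theorem exists_det_ne_zero [CharZero K] (hn : n ≠ 0)
    (hf : ∀ i, (f i).IsHomogeneous m) (hg : ∀ i, (g i).IsHomogeneous n)
    (hgcd : IsGCDOf 1 g) (hf0 : f 0 ≠ 0) (hg0 : g 0 ≠ 0)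
    (hdim : Module.finrank K (Submodule.span K (Set.range f)) = 3) :
    ∃ i j, Polynomial.aeval (X 0 : Bin K) (dehomWronskian f i) *
        Polynomial.aeval (X 1 : Bin K) (dehomWronskian g j) -
      Polynomial.aeval (X 0 : Bin K) (dehomWronskian f j) *
        Polynomial.aeval (X 1 : Bin K) (dehomWronskian g i) ≠ 0 := by
  by_contra! h
  obtain ⟨j, hj⟩ := exists_dehomWronskian_ne_zero hn hg hgcd hg0
  obtain ⟨z, hz⟩ : ∃ z, (dehomWronskian g j).eval z ≠ 0 := by
    by_contra! h
    exact hj (Polynomial.funext fun z => by rw [h, Polynomial.eval_zero])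
  have hlin : ∀ i, ∃ c d : K, f i = c • f j + d • f 0 := by
    intro i
    let c := (dehomWronskian g i).eval z / (dehomWronskian g j).eval z
    have h1 := congrArg (aeval ![(Polynomial.X : Polynomial K), Polynomial.C z]) (h i j)
    have hX : ∀ p : Polynomial K, aeval ![(Polynomial.X : Polynomial K), Polynomial.C z]
        (Polynomial.aeval (X 0 : Bin K) p) = p := by
      intro p
      rw [← Polynomial.aeval_algHom_apply]
      simp
    have hY : ∀ p : Polynomial K, aeval ![(Polynomial.X : Polynomial K), Polynomial.C z]
        (Polynomial.aeval (X 1 : Bin K) p) = Polynomial.C (p.eval z) := by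
      intro p
      rw [← Polynomial.aeval_algHom_apply]
      simp only [aeval_X, Matrix.cons_val_one, Matrix.cons_val_fin_one]
      exact Polynomial.aeval_algebraMap_apply _ _ _
    rw [map_sub, map_mul, map_mul, hX, hX, hY, hY, map_zero] at h1
    have h2 : dehomWronskian f i = Polynomial.C c * dehomWronskian f j := by
      have hz' : Polynomial.C ((dehomWronskian g j).eval z) ≠ 0 := by simpa using hz
      apply mul_right_cancel₀ hz'
      rw [mul_right_comm, ← Polynomial.C_mul, div_mul_cancel₀ _ hz]
      linear_combination h1
    obtain ⟨d, hd⟩ := exists_eq_C_mul_of_wronskian_dehomogenize_eq_zero (hf 0)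
      ((hf i).sub ((hf j).C_mul c)) hf0 (by
        have hsub : dehomogenize (f i - C c * f j) =
            dehomogenize (f i) - Polynomial.C c * dehomogenize (f j) := by
          simp [dehomogenize]
        rw [hsub, Polynomial.derivative_sub, Polynomial.derivative_C_mul]
        unfold dehomWronskian at h2
        linear_combination h2)
    refine ⟨c, d, ?_⟩
    rw [smul_eq_C_mul, smul_eq_C_mul]
    linear_combination hd
  have hle : Submodule.span K (Set.range f) ≤ Submodule.span K (Set.range ![f j, f 0]) := by
    rw [Submodule.span_le]
    rintro _ ⟨i, rfl⟩
    obtain ⟨c, d, hcd⟩ := hlin i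
    rw [hcd]
    exact Submodule.add_mem _ (Submodule.smul_mem _ _ (Submodule.subset_span ⟨0, rfl⟩))
      (Submodule.smul_mem _ _ (Submodule.subset_span ⟨1, rfl⟩))
  have : Module.Finite K (Submodule.span K (Set.range ![f j, f 0])) :=
    Module.Finite.span_of_finite K (Set.finite_range _)
  have h1 := Submodule.finrank_mono hle
  have h2 := finrank_range_le_card (R := K) ![f j, f 0]
  rw [Set.finrank] at h2
  rw [hdim] at h1
  simp at h2
  omega

/-- Among the components of the parameterization there are three algebraically independent ones,
one of them being the component with index `0`. -/
theorem exists_homogeneous_independent [CharZero K] (hn : n ≠ 0)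
    (hf : ∀ i, (f i).IsHomogeneous m) (hg : ∀ i, (g i).IsHomogeneous n)
    (hgcd : IsGCDOf 1 g) (hf0 : f 0 ≠ 0) (hg0 : g 0 ≠ 0)
    (hdim : Module.finrank K (Submodule.span K (Set.range f)) = 3) :
    ∃ i j : Fin 4, i ≠ 0 ∧ j ≠ 0 ∧ i ≠ j ∧ ∀ (G : MvPolynomial (Fin 3) K) (d : ℕ),
      G.IsHomogeneous d → paramHom (translational f g) (rename ![0, i, j] G) = 0 → G = 0 := by
  obtain ⟨i, j, hij⟩ := exists_det_ne_zero hn hf hg hgcd hf0 hg0 hdim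
  have hW0 : ∀ f : Fin 4 → Bin K, dehomWronskian f 0 = 0 := fun f => sub_self _
  refine ⟨i, j, ?_, ?_, ?_, ?_⟩
  · rintro rfl
    simp [hW0] at hij
  · rintro rfl
    simp [hW0] at hij
  · rintro rfl
    simp at hij
  intro G d hG hG0
  let P : Fin 3 → MvPolynomial (Fin 2) K :=
    fun k => Polynomial.aeval (X 0) (dehomogenize (f (![0, i, j] k)))
  let Q : Fin 3 → MvPolynomial (Fin 2) K :=
    fun k => Polynomial.aeval (X 1) (dehomogenize (g (![0, i, j] k)))
  have hD : ∀ (a b : Fin 2) (p : Polynomial K), pderiv a (Polynomial.aeval (X b : Bin K) p) =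
      Polynomial.aeval (X b) p.derivative * pderiv a (X b) := by
    intro a b p
    rw [Derivation.map_aeval, smul_eq_mul]
  have hinj : ∀ (b : Fin 2) (p : Polynomial K), p ≠ 0 → Polynomial.aeval (X b : Bin K) p ≠ 0 := by
    intro b p hp h
    apply hp
    have h1 := congrArg (aeval fun _ : Fin 2 => (Polynomial.X : Polynomial K)) h
    rw [← Polynomial.aeval_algHom_apply] at h1
    simpa using h1
  refine eq_zero_of_aeval_translational_eq_zero (pderiv 0) (pderiv 1) P Q (fun k => ?_)
    (fun k => ?_) (hinj _ _ (dehomogenize_ne_zero (hf 0) hf0))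
    (hinj _ _ (dehomogenize_ne_zero (hg 0) hg0)) ?_ d G hG ?_
  · simp [P, hD]
  · simp [Q, hD]
  · intro h
    apply hij
    simp only [P, Q, hD, pderiv_X_self, mul_one] at h
    simpa [dehomWronskian] using h
  · have h1 := congrArg (affineHom K) hG0
    rw [map_zero] at h1
    rw [← h1, paramHom, coe_eval₂Hom, eval₂_rename, ← coe_eval₂Hom, ← RingHom.comp_apply]
    have h2 : (affineHom K).comp (eval₂Hom (inTV.comp C) (translational f g ∘ ![0, i, j])) =
        (aeval fun k => P 0 * Q k + P k * Q 0 : _ →ₐ[K] Bin K).toRingHom := by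
      refine ringHom_ext (fun x => ?_) fun k => ?_
      · simp [affineHom, inTV]
      · simp [translational, affineHom_inSU, affineHom_inTV, P, Q]
    rw [h2]
    rfl

end Independence

/-! ### The kernel of the parameterization and the implicit equation -/

section ImplicitEquation

variable {K : Type*} [Field K] {f g : Fin 4 → Bin K} {m n : ℕ}

/-- A homomorphism from `D[X]` to a domain that is injective on constants has a principal kernel. -/
theorem dvd_of_map_eq_zero {D D' : Type*} [CommRing D] [IsDomain D] [CommRing D']
    (θ : Polynomial D →+* D') (hθ : ∀ c, θ (Polynomial.C c) = 0 → c = 0) {F G : Polynomial D}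
    (hF : Prime F) (hF0 : θ F = 0) (hG0 : θ G = 0) : F ∣ G := by
  by_contra hFG
  have hdeg : F.natDegree ≠ 0 := by
    intro h
    rw [Polynomial.eq_C_of_natDegree_eq_zero h] at hF0
    apply hF.ne_zero
    rw [Polynomial.eq_C_of_natDegree_eq_zero h, hθ _ hF0, map_zero]
  -- As the prime `F` does not divide `G`, the resultant is a nonzero constant in the ideal of `F`
  -- and `G`; but `θ` kills that ideal and is injective on constants.
  have hres : Polynomial.resultant F G F.natDegree G.natDegree ≠ 0 := by
    intro h
    obtain ⟨u, v, hu, -, huv, hne⟩ := exists_relation_of_resultant_eq_zero le_rfl le_rfl h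
    have hFu : F ∣ u := by
      refine (hF.dvd_or_dvd (a := G) (b := u) ⟨-v, ?_⟩).resolve_left hFG
      linear_combination huv
    have hu0 : u = 0 := by
      by_contra hu0
      rw [← Polynomial.natDegree_lt_iff_degree_lt hu0] at hu
      have := Polynomial.natDegree_le_of_dvd hFu hu0
      omega
    rw [hu0, mul_zero, add_zero] at huv
    exact hne.elim (fun h => h hu0) fun h => h ((mul_eq_zero.1 huv).resolve_left hF.ne_zero)
  obtain ⟨u, v, -, -, huv⟩ := Polynomial.exists_mul_add_mul_eq_C_resultant F G le_rfl le_rfl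
    (Or.inl hdeg)
  apply hres
  apply hθ
  rw [← huv, map_add, map_mul, map_mul, hF0, hG0, zero_mul, zero_mul, add_zero]

theorem scalesBy_paramHom {h : Fin 4 → BiRing K}
    (hh : ∀ i s, (coeff s (h i)).IsHomogeneous n) {G : Coord K} {d : ℕ} (hG : G.IsHomogeneous d) :
    ScalesBy (gscaleInner (Fin 2) (Fin 2) K) (n * d) (paramHom h G) := by
  have h1 : ∀ θ : BiRing K →+* Polynomial (BiRing K),
      θ.comp (inTV.comp C) = algebraMap K (Polynomial (BiRing K)) →
      θ (paramHom h G) = aeval (fun i => θ (h i)) G := by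
    intro θ hθ
    rw [paramHom, coe_eval₂Hom, eval₂_comp_left, hθ]
    rfl
  unfold ScalesBy
  rw [h1 _ (by ext x : 1; simp [inTV, gscaleInner, gscale]), h1 Polynomial.C rfl]
  rw [pow_mul, ← aeval_smul_of_isHomogeneous hG]
  congr 2
  funext i
  exact scalesBy_gscaleInner_iff.2 (hh i)

/-- Components of different degree `e` land in different degrees `n * e` in `t, v`, so the kernel is
a graded ideal. -/
theorem paramHom_homogeneousComponent_eq_zero {h : Fin 4 → BiRing K}
    (hh : ∀ i s, (coeff s (h i)).IsHomogeneous n) (hn : n ≠ 0) {G : Coord K}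
    (hG : paramHom h G = 0) (d : ℕ) : paramHom h (homogeneousComponent d G) = 0 := by
  have h1 := congrArg (gscaleInner (Fin 2) (Fin 2) K) hG
  rw [← sum_homogeneousComponent G, map_sum, map_sum, map_zero] at h1
  have h2 : ∀ e, gscaleInner (Fin 2) (Fin 2) K (paramHom h (homogeneousComponent e G)) =
      Polynomial.X ^ (n * e) * Polynomial.C (paramHom h (homogeneousComponent e G)) :=
    fun e => scalesBy_paramHom hh (homogeneousComponent_isHomogeneous e G)
  simp only [h2] at h1
  have h3 := congrArg (fun r => Polynomial.coeff r (n * d)) h1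
  simp only [Polynomial.finsetSum_coeff, Polynomial.X_pow_mul_C, Polynomial.coeff_C_mul_X_pow,
    Polynomial.coeff_zero, mul_right_inj' hn, Finset.sum_ite_eq, Finset.mem_range] at h3
  split_ifs at h3 with hd
  · exact h3
  · rw [homogeneousComponent_eq_zero _ _ (by omega), map_zero]

theorem isHomogeneous_coeff_translational (hg : ∀ i, (g i).IsHomogeneous n) (i : Fin 4)
    (s : Fin 2 →₀ ℕ) : (coeff s (translational f g i)).IsHomogeneous n := by
  have h1 : coeff s (translational f g i) = C (coeff s (f 0)) * g i + C (coeff s (f i)) * g 0 := by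
    rw [translational, mul_comm, mul_comm (inSU (f i)), coeff_add, inTV, coeff_C_mul, coeff_C_mul,
      inSU, coeff_map, coeff_map]
    ring
  rw [h1]
  exact ((hg i).C_mul _).add ((hg 0).C_mul _)

/-- The remaining index goes to position `0`, where `finSuccEquiv` makes its variable the main one
over the three independent ones. -/
theorem exists_perm_succ_eq {i j : Fin 4} (hi : i ≠ 0) (hj : j ≠ 0) (hij : i ≠ j) :
    ∃ ρ : Equiv.Perm (Fin 4), ∀ l : Fin 3, ρ l.succ = ![0, i, j] l := by
  have h : ∀ i j : Fin 4, i ≠ 0 → j ≠ 0 → i ≠ j → ∃ k, Function.Injective ![k, 0, i, j] := by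
    decide
  obtain ⟨k, hk⟩ := h i j hi hj hij
  refine ⟨Equiv.ofBijective _ (Finite.injective_iff_bijective.1 hk), fun l => ?_⟩
  fin_cases l <;> rfl

/-- The polynomials vanishing on the translational surface are the multiples of any irreducible one
among them. -/
theorem dvd_of_paramHom_eq_zero [CharZero K] (hn : n ≠ 0)
    (hf : ∀ i, (f i).IsHomogeneous m) (hg : ∀ i, (g i).IsHomogeneous n)
    (hgcd : IsGCDOf 1 g) (hf0 : f 0 ≠ 0) (hg0 : g 0 ≠ 0)
    (hdim : Module.finrank K (Submodule.span K (Set.range f)) = 3) {F G : Coord K}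
    (hF : Irreducible F) (hF0 : paramHom (translational f g) F = 0)
    (hG0 : paramHom (translational f g) G = 0) : F ∣ G := by
  obtain ⟨i, j, hi, hj, hij, hindep⟩ :=
    exists_homogeneous_independent hn hf hg hgcd hf0 hg0 hdim
  obtain ⟨ρ, hρ⟩ := exists_perm_succ_eq hi hj hij
  let e : Coord K ≃ₐ[K] Polynomial (MvPolynomial (Fin 3) K) :=
    (renameEquiv K ρ.symm).trans (finSuccEquiv K 3)
  have he : ∀ c, e (rename ![0, i, j] c) = Polynomial.C c := by
    intro c
    have h1 : (e : Coord K →ₐ[K] _).comp (rename ![0, i, j]) =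
        (Polynomial.CAlgHom : MvPolynomial (Fin 3) K →ₐ[MvPolynomial (Fin 3) K] _).restrictScalars
          K := by
      refine algHom_ext fun l => ?_
      have h2 : ρ.symm (![0, i, j] l) = l.succ := by rw [← hρ, Equiv.symm_apply_apply]
      change finSuccEquiv K 3 (rename ρ.symm (rename ![0, i, j] (X l))) = Polynomial.C (X l)
      rw [rename_X, rename_X, h2, finSuccEquiv_X_succ]
    exact DFunLike.congr_fun h1 c
  rw [← map_dvd_iff e]
  refine dvd_of_map_eq_zero ((paramHom (translational f g)).comp (e.symm : _ →+* Coord K))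
    (fun c hc => ?_) ((MulEquiv.prime_iff e).2 hF.prime) (by simpa using hF0) (by simpa using hG0)
  rw [← he] at hc
  simp only [RingHom.comp_apply, RingHom.coe_coe, AlgEquiv.symm_apply_apply] at hc
  rw [← sum_homogeneousComponent c]
  refine Finset.sum_eq_zero fun d _ => ?_
  refine hindep _ d (homogeneousComponent_isHomogeneous d c) ?_
  rw [rename_homogeneousComponent]
  exact paramHom_homogeneousComponent_eq_zero (isHomogeneous_coeff_translational hg) hn hc d

theorem eval_evalParam (h : Fin 4 → BiRing K) (p q : Fin 2 → K) (G : Coord K) :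
    eval (evalParam h p q) G = eval p (map (eval q) (paramHom h G)) := by
  have h1 : eval (evalParam h p q) = (eval p).comp ((map (eval q)).comp (paramHom h)) := by
    refine ringHom_ext (fun x => ?_) fun i => ?_
    · simp [paramHom, inTV]
    · simp [paramHom, evalParam]
  rw [h1]
  rfl

theorem eq_zero_of_forall_eval_map_eval [Infinite K] {T : BiRing K}
    (hT : ∀ p q : Fin 2 → K, eval p (map (eval q) T) = 0) : T = 0 := by
  ext1 s
  refine MvPolynomial.funext fun q => ?_
  have h1 : map (eval q) T = 0 := MvPolynomial.funext fun p => by rw [hT, map_zero]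
  rw [← coeff_map, h1, coeff_zero, coeff_zero, map_zero]

theorem eval_rep_mk_eq_zero_iff {G : Coord K} {d : ℕ} (hG : G.IsHomogeneous d) {v : Fin 4 → K}
    (hv : v ≠ 0) : eval (Projectivization.mk K v hv).rep G = 0 ↔ eval v G = 0 := by
  obtain ⟨a, ha⟩ := Projectivization.exists_smul_eq_mk_rep K v hv
  rw [← ha, Units.smul_def, eval_smul_of_isHomogeneous hG, mul_eq_zero,
    or_iff_right (pow_ne_zero _ a.ne_zero)]

theorem isImplicitEquation_of_forall_dvd [Infinite K] {h : Fin 4 → BiRing K} {i : Fin 4}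
    (hi : h i ≠ 0) {F : Coord K} {d : ℕ} (hF : Irreducible F) (hFd : F.IsHomogeneous d)
    (hF0 : paramHom h F = 0) (hdvd : ∀ G, paramHom h G = 0 → F ∣ G) :
    IsImplicitEquation h F := by
  refine ⟨hF, ⟨d, hFd⟩, Set.Subset.antisymm ?_ ?_⟩
  · intro P hP e G hG hvan
    have hG0 : paramHom h G = 0 := by
      -- The factor `u v hᵢ` vanishes wherever `p`, `q` or the value of `h` fails to define a point,
      -- so the product vanishes everywhere.
      have hT : paramHom h G * (X 1 * inTV (X 1) * h i) = 0 := by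
        refine eq_zero_of_forall_eval_map_eval fun p q => ?_
        simp only [map_mul, map_X, inTV, map_C, eval_X, eval_C]
        rw [← eval_evalParam]
        by_cases hp : p 1 = 0
        · simp [hp]
        by_cases hq : q 1 = 0
        · simp [hq]
        by_cases hv : evalParam h p q = 0
        · have h1 : eval p (map (eval q) (h i)) = 0 := congrFun hv i
          rw [h1]
          simp
        · have h1 := hvan _ ⟨p, q, fun h => hp (congrFun h 1), fun h => hq (congrFun h 1), hv, rfl⟩
          rw [(eval_rep_mk_eq_zero_iff hG hv).1 h1, zero_mul]
      refine (mul_eq_zero.1 hT).resolve_right (mul_ne_zero (mul_ne_zero (X_ne_zero 1) ?_) hi)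
      simp [inTV]
    obtain ⟨c, rfl⟩ := hdvd G hG0
    have hP' : eval P.rep F = 0 := hP
    rw [map_mul, hP', zero_mul]
  · intro P hP
    refine hP d F hFd ?_
    rintro _ ⟨p, q, -, -, hv, rfl⟩
    rw [eval_rep_mk_eq_zero_iff hFd hv, eval_evalParam, hF0, map_zero, map_zero]

theorem translational_zero_ne_zero [CharZero K] (hf0 : f 0 ≠ 0) (hg0 : g 0 ≠ 0) :
    translational f g 0 ≠ 0 := by
  have h1 : translational f g 0 = 2 * (inSU (f 0) * inTV (g 0)) := by
    rw [translational]
    ring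
  rw [h1]
  refine mul_ne_zero two_ne_zero (mul_ne_zero ?_ ?_)
  · exact (map_ne_zero_iff _ (map_injective _ (C_injective _ _))).2 hf0
  · exact (map_ne_zero_iff _ (C_injective _ _)).2 hg0

theorem exists_isImplicitEquation [CharZero K] (hn : n ≠ 0)
    (hf : ∀ i, (f i).IsHomogeneous m) (hg : ∀ i, (g i).IsHomogeneous n)
    (hgcd : IsGCDOf 1 g) (hf0 : f 0 ≠ 0) (hg0 : g 0 ≠ 0)
    (hdim : Module.finrank K (Submodule.span K (Set.range f)) = 3) {G : Coord K} (hG : G ≠ 0)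
    (hG0 : paramHom (translational f g) G = 0) :
    ∃ F, IsImplicitEquation (translational f g) F ∧ Irreducible F ∧
      ∀ G, paramHom (translational f g) G = 0 → F ∣ G := by
  -- Irreducible factors of a homogeneous component are forms, as needed for `F`.
  obtain ⟨d, hd⟩ : ∃ d, homogeneousComponent d G ≠ 0 := by
    by_contra! h
    apply hG
    rw [← sum_homogeneousComponent G]
    exact Finset.sum_eq_zero fun d _ => h d
  obtain ⟨F, hF, hFG, hF0⟩ := exists_irreducible_dvd_map_eq_zero _ hd
    (paramHom_homogeneousComponent_eq_zero (isHomogeneous_coeff_translational hg) hn hG0 d)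
  obtain ⟨e, he⟩ :=
    exists_isHomogeneous_of_dvd hFG (homogeneousComponent_isHomogeneous d G) hd
  have hdvd := fun G hG => dvd_of_paramHom_eq_zero (G := G) hn hf hg hgcd hf0 hg0 hdim hF hF0 hG
  exact ⟨F, isImplicitEquation_of_forall_dvd (translational_zero_ne_zero hf0 hg0) hF he hF0 hdvd,
    hF, hdvd⟩

end ImplicitEquation

end

end TransSurf

/-! ### The main theorem -/

theorem mainTheorem1 {K : Type*} [Field K] [IsAlgClosed K] [CharZero K] (m n : ℕ) (hn : 1 ≤ n)
    (f g : Fin 4 → TransSurf.Bin K)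
    (hf : ∀ i, (f i).IsHomogeneous m) (hg : ∀ i, (g i).IsHomogeneous n)
    (hf_gcd : TransSurf.IsGCDOf 1 f) (hg_gcd : TransSurf.IsGCDOf 1 g)
    (hf0 : f 0 ≠ 0) (hg0 : g 0 ≠ 0)
    (hdim : Module.finrank K (Submodule.span K (Set.range f)) = 3)
    (μ : Fin 3 → ℕ) (φ : Matrix (Fin 4) (Fin 3) (TransSurf.Bin K))
    (hφ : TransSurf.IsSyzygyMatrix f μ φ)
    (A B C : Fin 4 → TransSurf.BiRing K)
    (hA : TransSurf.IsPrimitivePart (TransSurf.inducedSyzygy g fun i => φ i 0) A)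
    (hB : TransSurf.IsPrimitivePart (TransSurf.inducedSyzygy g fun i => φ i 1) B)
    (hC : TransSurf.IsPrimitivePart (TransSurf.inducedSyzygy g fun i => φ i 2) C) :
    ∃ xA : TransSurf.TVCoord K,
      -- the moving plane of `A` does not involve `s` and `u`
      MvPolynomial.C xA = TransSurf.movingPlane A ∧
      ¬ xA ∣ TransSurf.homResultant (TransSurf.movingPlane B) (TransSurf.movingPlane C) ∧
      (∃ F₁ : TransSurf.TVCoord K, Irreducible F₁ ∧
        F₁ ∣ TransSurf.homResultant (TransSurf.movingPlane B) (TransSurf.movingPlane C) ∧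
        TransSurf.Follows (TransSurf.translational f g) F₁) ∧
      ∃ F : TransSurf.Coord K,
        TransSurf.IsImplicitEquation (TransSurf.translational f g) F ∧
        ∀ F₁ : TransSurf.TVCoord K, Irreducible F₁ →
          F₁ ∣ TransSurf.homResultant (TransSurf.movingPlane B) (TransSurf.movingPlane C) →
          TransSurf.Follows (TransSurf.translational f g) F₁ →
          TransSurf.homResultant xA F₁ ≠ 0 ∧
          ∃ E : TransSurf.Coord K, TransSurf.homResultant xA F₁ = E * F := by
  open TransSurf in
  have hμ0 := hφ.degree_zero hdim
  have hμ1 := hφ.degree_one_ne_zero hdim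
  have hprim : ∀ (j : Fin 3) (V : Fin 4 → BiRing K),
      IsPrimitivePart (inducedSyzygy g fun i => φ i j) V →
      ∃ β δ, IsPrimitiveInduced g (fun i => φ i j) V (μ j) β δ := fun j V hV =>
    hV.exists_isPrimitiveInduced hg hg0 (fun i => hφ.isHomogeneous i j)
      fun e he => hφ.isUnit_of_dvd_column he
  obtain ⟨α, δ, hA'⟩ := hprim 0 A hA
  obtain ⟨β, δ₁, hB'⟩ := hprim 1 B hB
  obtain ⟨γ, δ₂, hC'⟩ := hprim 2 C hC
  rw [hμ0] at hA'
  obtain ⟨a, rfl⟩ : ∃ a : Fin 4 → Bin K, A = fun i => MvPolynomial.C (a i) :=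
    ⟨_, funext fun i => eq_C_of_isHomogeneous_zero (hA'.isHomogeneous i)⟩
  have ha : ∀ e, (∀ i, e ∣ a i) → IsUnit e := fun e he => by
    have := hA'.isUnit_of_dvd (MvPolynomial.C e) fun i => map_dvd _ (he i)
    simpa using this.map MvPolynomial.constantCoeff
  have haα : ∀ i, (a i).IsHomogeneous α := fun i => by
    simpa using hA'.isHomogeneous_coeff i 0
  have hxA0 := tvPlane_ne_zero ha
  have hxAp := prime_tvPlane ha
  have hxAα := isHomogeneous_tvPlane haα
  have hxAh : substParam (translational f g) (tvPlane a) = 0 := by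
    rw [substParam_tvPlane]
    exact hA'.sum_mul_eq_zero hg0 (hφ.sum_mul_eq_zero 0)
  have hres : homResultant (movingPlane B) (movingPlane C) = Polynomial.resultant
      (dehomogenize (movingPlane B)) (dehomogenize (movingPlane C)) (μ 1) (μ 2) := by
    rw [homResultant,
      (isHomogeneous_movingPlane hB'.isHomogeneous).totalDegree hB'.movingPlane_ne_zero,
      (isHomogeneous_movingPlane hC'.isHomogeneous).totalDegree hC'.movingPlane_ne_zero]
  have hndvd := not_tvPlane_dvd_resultant hf hf_gcd hf0 hg0 hφ hμ0 hμ1 hA' hB' hC'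
  have hres0 := substParam_resultant_eq_zero (translational f g) hB'.isHomogeneous
    hC'.isHomogeneous hμ1 (hB'.sum_mul_eq_zero hg0 (hφ.sum_mul_eq_zero 1))
    (hC'.sum_mul_eq_zero hg0 (hφ.sum_mul_eq_zero 2))
  -- The resultant is homogeneous both in `w, x, y, z` and in `t, v`; its factors inherit both
  -- gradings.
  have hresX := ScalesBy.resultant (d := μ 1) (e := μ 2)
    (scalesBy_gscaleInner_coeff_movingPlane B) (scalesBy_gscaleInner_coeff_movingPlane C)
  have hresT := ScalesBy.resultant (d := μ 1) (e := μ 2)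
    (scalesBy_gscale_coeff_movingPlane hB'.isHomogeneous_coeff)
    (scalesBy_gscale_coeff_movingPlane hC'.isHomogeneous_coeff)
  rw [← hres] at hndvd hres0 hresX hresT
  set R := homResultant (movingPlane B) (movingPlane C)
  have hR0 : R ≠ 0 := fun h => hndvd (h ▸ dvd_zero _)
  have hdeg : ∀ F₁, F₁ ∣ R → ∃ e, F₁.IsHomogeneous e := fun F₁ h =>
    exists_isHomogeneous_of_dvd h (scalesBy_gscale_iff.1 hresT) hR0
  have hne : ∀ F₁, Irreducible F₁ → F₁ ∣ R → homResultant (tvPlane a) F₁ ≠ 0 := by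
    intro F₁ hF₁ hF₁R
    obtain ⟨e, he⟩ := hdeg F₁ hF₁R
    rw [homResultant, hxAα.totalDegree hxA0, he.totalDegree hF₁.ne_zero]
    exact resultant_ne_zero_of_isRelPrime hxAα he hxA0 hF₁.ne_zero
      (isRelPrime_of_prime_of_not_dvd hxAp fun h => hndvd (h.trans hF₁R))
  have hker : ∀ F₁ e, Irreducible F₁ → F₁.IsHomogeneous e → (α ≠ 0 ∨ e ≠ 0) →
      substParam (translational f g) F₁ = 0 →
      paramHom (translational f g) (homResultant (tvPlane a) F₁) = 0 := by
    intro F₁ e hF₁ he hαe h0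
    rw [homResultant, hxAα.totalDegree hxA0, he.totalDegree hF₁.ne_zero]
    exact paramHom_resultant_eq_zero _ hxAα he hαe hxAh h0
  have hconst : ∀ L : TVCoord K, L.IsHomogeneous 0 → substParam (translational f g) L = 0 →
      ∃ L', L = MvPolynomial.C L' ∧ paramHom (translational f g) L' = 0 := by
    intro L hL h0
    have hL' := eq_C_of_isHomogeneous_zero hL
    rw [hL', substParam_C] at h0
    exact ⟨_, hL', h0⟩
  obtain ⟨F₁, hF₁, hF₁R, hF₁h⟩ := exists_irreducible_dvd_map_eq_zero _ hR0 hres0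
  have hker0 : ∃ G, G ≠ 0 ∧ paramHom (translational f g) G = 0 := by
    obtain ⟨e, he⟩ := hdeg F₁ hF₁R
    -- If `xA` is free of `t, v`, it is itself a kernel element; otherwise `Res_tv(xA, F₁)` is one.
    by_cases hα : α = 0
    · obtain ⟨L, hL, hL0⟩ := hconst _ (hα ▸ hxAα) hxAh
      refine ⟨L, ?_, hL0⟩
      rintro rfl
      exact hxA0 (by rw [hL, map_zero])
    · exact ⟨_, hne F₁ hF₁ hF₁R, hker F₁ e hF₁ he (Or.inl hα) hF₁h⟩
  obtain ⟨G, hG, hG0⟩ := hker0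
  obtain ⟨F, hFimp, hF, hFdvd⟩ := exists_isImplicitEquation (by omega : n ≠ 0) hf hg hg_gcd hf0 hg0
    hdim hG hG0
  refine ⟨tvPlane a, (movingPlane_C a).symm, hndvd, ⟨F₁, hF₁, hF₁R, ?_, hF₁h⟩, F, hFimp, ?_⟩
  · obtain ⟨S, hS⟩ := hF₁R
    rw [hS] at hresX hR0
    obtain ⟨d, -, hd, -⟩ := ScalesBy.of_mul eval_one_gscaleInner hresX hR0
    exact ⟨d, scalesBy_gscaleInner_iff.1 hd⟩
  · intro F₂ hF₂ hF₂R hF₂h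
    refine ⟨hne F₂ hF₂ hF₂R, ?_⟩
    obtain ⟨e, he⟩ := hdeg F₂ hF₂R
    have hdvd : F ∣ homResultant (tvPlane a) F₂ := by
      by_cases hαe : α ≠ 0 ∨ e ≠ 0
      · exact hFdvd _ (hker F₂ e hF₂ he hαe hF₂h.2)
      -- Here `xA` and `F₂` both lie in `K[w,x,y,z]` and in the kernel, so `F` divides both. As `xA`
      -- is irreducible it is associated to `F`, so it divides `F₂` and thus `R`.
      · exfalso
        push Not at hαe
        obtain ⟨rfl, rfl⟩ := hαe
        obtain ⟨L, hL, hL0⟩ := hconst _ hxAα hxAh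
        obtain ⟨L', hL', hL0'⟩ := hconst _ he hF₂h.2
        have hCF : ¬ IsUnit (MvPolynomial.C F : TVCoord K) := fun h =>
          hF.not_isUnit (by simpa using h.map MvPolynomial.constantCoeff)
        have h1 : (MvPolynomial.C F : TVCoord K) ∣ tvPlane a := hL ▸ map_dvd _ (hFdvd L hL0)
        have h2 : (MvPolynomial.C F : TVCoord K) ∣ F₂ := hL' ▸ map_dvd _ (hFdvd L' hL0')
        have h3 := (hxAp.irreducible.dvd_iff.1 h1).resolve_left hCF
        exact hndvd ((h3.dvd.trans h2).trans hF₂R)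
    obtain ⟨E, hE⟩ := hdvd
    exact ⟨E, by rw [hE, mul_comm]⟩
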